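/- Let $\Omega$ be a finite set of states with a prior $\mu\in\Delta(\Omega)$, let $A$ be a finite nonempty set of actions, let $u_S,u_R:\Omega\times A\to\mathbb R$ be the payoff functions of a sender $S$ and a receiver $R$, and let $Q:X\to\Delta(Y)$ be a channel with finite nonempty input set $X$ and finite output set $Y$. All logarithms are in base $2$, and $0\log 0=0$. **The game.** For integers $n\ge 1$ and $k\ge 0$ let $\mu^n(\omega^n)=\prod_{t=1}^n\mu(\omega_t)$, $Q^k(y^k|x^k)=\prod_{t=1}^kQ(y_t|x_t)$ and $\bar u_i(\omega^n,a^n)=\frac1n\sum_{t=1}^nu_i(\omega_t,a_t)$. A strategy of the sender is a map $\sigma:\Omega^n\to\Delta(X^k)$. The set $BR(\sigma)$ of best replies consists of the maps $\tau:Y^k\to A^n$ such that for every $y^k$ $$\tau(y^k)\in\operatorname*{argmax}_{a^n\in A^n}\sum_{\omega^n,x^k}\mu^n(\omega^n)\sigma(x^k|\omega^n)Q^k(y^k|x^k)\bar u_R(\omega^n,a^n).$$ The optimal robust payoff of the sender is $$U^*_S(\mu^n,Q^k)=\sup_\sigma\min_{\tau\in BR(\sigma)}\sum_{\omega^n,x^k,y^k}\mu^n(\omega^n)\sigma(x^k|\omega^n)Q^k(y^k|x^k)\,\bar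 u_S(\omega^n,\tau(y^k)).$$ **The splitting problem.** For $\nu\in\Delta(\Omega)$ let $A^*(\nu)=\operatorname{argmax}_{a\in A}\sum_\omega\nu(\omega)u_R(\omega,a)$ and $u^*_S(\nu)=\min_{a\in A^*(\nu)}\sum_\omega\nu(\omega)u_S(\omega,a)$. Let $H(q)=-\sum_sq(s)\log q(s)$ be the entropy, and let $$C(Q)=\max_{p\in\Delta(X)}\Big[H\Big(\sum_xp(x)Q(\cdot|x)\Big)-\sum_xp(x)H(Q(\cdot|x))\Big]$$ be the capacity of the channel. For $c\in[0,+\infty]$ let $$V(\mu,c)=\sup\Big\{\sum_m\lambda_mu^*_S(\nu_m)\;:\;\sum_m\lambda_m\nu_m=\mu,\ H(\mu)-\sum_m\lambda_mH(\nu_m)\le c\Big\},$$ where the supremum is over finite families $(\lambda_m,\nu_m)_m$ with $\nu_m\in\Delta(\Omega)$, $\lambda_m\ge0$, $\sum_m\lambda_m=1$. **Theorem.** 1. For all integers $n\ge1$ and $k\ge0$, $\;U^*_S(\mu^n,Q^k)\le V\big(\mu,\tfrac knC(Q)\big)$. 2. Let $r\in[0,+\infty]$ and let $(n_j)_j,(k_j)_j$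 be sequences of integers with $n_j\ge1$, $k_j\ge0$, $\max(n_j,k_j)\to\infty$ and $k_j/n_j\to r$. If $r=0$ and $C(Q)>0$, assume in addition that $u^*_S$, restricted to the beliefs $\nu\in\Delta(\Omega)$ whose support is contained in that of $\mu$, is continuous at $\mu$. Then $$\lim_{j\to\infty}U^*_S(\mu^{n_j},Q^{k_j})=V\big(\mu,rC(Q)\big),\qquad\text{with the convention }(+\infty)\cdot0=0.$$ -/

import Mathlib

/-!
Finite probability distributions are elements of `stdSimplex ℝ S`; a transition probability from
`S` to `T` is a map `P : S → T → ℝ` with `P s ∈ stdSimplex ℝ T` for every `s`.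
-/

namespace Persuasion

noncomputable section

/-- Shannon entropy in bits (with `0 log 0 = 0`). -/
def entropy {S : Type*} [Fintype S] (q : S → ℝ) : ℝ :=
  -∑ s, q s * Real.logb 2 (q s)

/-- Mutual information between input and output of the channel `Q` when the input has law `p`. -/
def mutualInfo {X Y : Type*} [Fintype X] [Fintype Y] (p : X → ℝ) (Q : X → Y → ℝ) : ℝ :=
  entropy (fun y => ∑ x, p x * Q x y) - ∑ x, p x * entropy (Q x)

/-- Channel capacity: the maximum of the mutual information over all input distributions. -/
def capacity {X Y : Type*} [Fintype X] [Fintype Y] (Q : X → Y → ℝ) : ℝ :=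
  sSup ((fun p => mutualInfo p Q) '' stdSimplex ℝ X)

/-- Expected value of `u (·, a)` at the belief `ν`. -/
def expPayoff {Ω A : Type*} [Fintype Ω] (u : Ω → A → ℝ) (ν : Ω → ℝ) (a : A) : ℝ :=
  ∑ ω, ν ω * u ω a

/-- The receiver's optimal actions at the belief `ν`. -/
def optActions {Ω A : Type*} [Fintype Ω] (uR : Ω → A → ℝ) (ν : Ω → ℝ) : Set A :=
  {a | ∀ b, expPayoff uR ν b ≤ expPayoff uR ν a}

/-- The sender's robust payoff at the belief `ν`: the minimum over the receiver's optimal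
actions (a nonempty finite set when `A` is finite and nonempty). -/
def robustPayoff {Ω A : Type*} [Fintype Ω] (uS uR : Ω → A → ℝ) (ν : Ω → ℝ) : ℝ :=
  sInf (expPayoff uS ν '' optActions uR ν)

/-- `(lam m, ν m)`, `m : Fin M`, is a splitting of `μ`. -/
structure IsSplitting {Ω : Type*} [Fintype Ω] (μ : Ω → ℝ) {M : ℕ}
    (lam : Fin M → ℝ) (ν : Fin M → Ω → ℝ) : Prop where
  weights : lam ∈ stdSimplex ℝ (Fin M)
  posteriors : ∀ m, ν m ∈ stdSimplex ℝ Ω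
  average : ∀ ω, ∑ m, lam m * ν m ω = μ ω

/-- Expected reduction of entropy of a splitting, i.e. the mutual information between the state
and the message. -/
def splittingInfo {Ω : Type*} [Fintype Ω] (μ : Ω → ℝ) {M : ℕ}
    (lam : Fin M → ℝ) (ν : Fin M → Ω → ℝ) : ℝ :=
  entropy μ - ∑ m, lam m * entropy (ν m)

/-- Value of the optimal splitting problem with information constraint `c`, where `c = ⊤` means
that there is no constraint. -/
def splittingValue {Ω A : Type*} [Fintype Ω] (uS uR : Ω → A → ℝ) (μ : Ω → ℝ) (c : EReal) : ℝ :=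
  sSup {v | ∃ (M : ℕ) (lam : Fin M → ℝ) (ν : Fin M → Ω → ℝ),
    IsSplitting μ lam ν ∧ ((splittingInfo μ lam ν : ℝ) : EReal) ≤ c ∧
    v = ∑ m, lam m * robustPayoff uS uR (ν m)}

/-- Product law of `n` i.i.d. states. -/
def iidLaw {Ω : Type*} (μ : Ω → ℝ) {n : ℕ} (ω : Fin n → Ω) : ℝ :=
  ∏ t, μ (ω t)

/-- `k` independent uses of the channel `Q`. -/
def channelPow {X Y : Type*} (Q : X → Y → ℝ) {k : ℕ} (x : Fin k → X) (y : Fin k → Y) : ℝ :=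
  ∏ t, Q (x t) (y t)

/-- Average payoff over the `n` problems. -/
def avgPayoff {Ω A : Type*} (u : Ω → A → ℝ) {n : ℕ} (ω : Fin n → Ω) (a : Fin n → A) : ℝ :=
  (1 / (n : ℝ)) * ∑ t, u (ω t) (a t)

/-- Strategies of the sender: transition probabilities from `Ω ^ n` to `X ^ k`. -/
def senderStrategies (Ω X : Type*) [Fintype X] (n k : ℕ) :
    Set ((Fin n → Ω) → (Fin k → X) → ℝ) :=
  {σ | ∀ ω, σ ω ∈ stdSimplex ℝ (Fin k → X)}

/-- Best replies of the receiver to the sender's strategy `σ`: for every output sequence `y`,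
the action sequence `τ y` maximizes the expected average payoff given `y` (unnormalized). -/
def bestReplies {Ω A X Y : Type*} [Fintype Ω] [Fintype X]
    (uR : Ω → A → ℝ) (μ : Ω → ℝ) (Q : X → Y → ℝ) {n k : ℕ}
    (σ : (Fin n → Ω) → (Fin k → X) → ℝ) : Set ((Fin k → Y) → (Fin n → A)) :=
  {τ | ∀ y, ∀ a : Fin n → A,
    ∑ ω, ∑ x, iidLaw μ ω * σ ω x * channelPow Q x y * avgPayoff uR ω a ≤
      ∑ ω, ∑ x, iidLaw μ ω * σ ω x * channelPow Q x y * avgPayoff uR ω (τ y)}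

/-- Expected average payoff of the sender under the strategies `σ` and `τ`. -/
def senderPayoff {Ω A X Y : Type*} [Fintype Ω] [Fintype X] [Fintype Y]
    (uS : Ω → A → ℝ) (μ : Ω → ℝ) (Q : X → Y → ℝ) {n k : ℕ}
    (σ : (Fin n → Ω) → (Fin k → X) → ℝ) (τ : (Fin k → Y) → (Fin n → A)) : ℝ :=
  ∑ ω, ∑ x, ∑ y, iidLaw μ ω * σ ω x * channelPow Q x y * avgPayoff uS ω (τ y)

/-- Optimal robust payoff of the sender with `n` problems and `k` uses of the channel: the
supremum over the sender's strategies of the minimum over the receiver's best replies. -/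
def optimalRobustPayoff {Ω A X Y : Type*} [Fintype Ω] [Fintype X] [Fintype Y]
    (uS uR : Ω → A → ℝ) (μ : Ω → ℝ) (Q : X → Y → ℝ) (n k : ℕ) : ℝ :=
  sSup ((fun σ => sInf (senderPayoff uS μ Q σ '' bestReplies uR μ Q σ)) ''
    senderStrategies Ω X n k)

end

end Persuasion

/-!
Upper bound. Best replies act separately on each problem, so the sender's payoff is an average over
problems and outputs of robust payoffs at the marginal beliefs. These beliefs form a splitting of
`μ` whose information is at most `k / n` times the capacity, by subadditivity of the entropy and
data processing.

Achievability. Fix a splitting whose posteriors have full support and whose information is strictly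
below the bound. Greedy covering produces few words of intended posteriors such that almost every
sequence of states fits one of them; the index of that word is sent with Feinstein's channel code.
Fit is measured by a score, the intended payoff plus `K` times the log-likelihood. Robust payoffs
are only lower semicontinuous, but by Pinsker's inequality the loss at a perturbed belief is at most
`ε` plus `K` times its divergence from the intended belief. The likelihood part of the score pays
for the average divergence, since the index carries hardly more information than the splitting.

Limits. Mixing posteriors with the prior makes the support full and the information constraint
slack; mixing a splitting with the trivial one shows that the value is upper semicontinuous at
positive capacities. At capacity zero the continuity of the robust payoff at `μ` takes over.
-/

namespace Persuasion

open Finset Real Filter Topology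

noncomputable section

section Entropy

variable {S T ι : Type*} [Fintype S] [Fintype T] [Fintype ι]

/-- Entropy in nats of a finite measure `q`, extended from probability distributions by positive
homogeneity: for a joint law of a state and a message, the sum over the messages of the entropies
of the unnormalized conditional laws is then the conditional entropy. -/
def massEntropy (q : S → ℝ) : ℝ :=
  ∑ s, q s * (log (∑ s, q s) - log (q s))

/-- Cross entropy in nats. -/
def crossEntropy (q r : S → ℝ) : ℝ :=
  -∑ s, q s * log (r s)

/-- Kullback–Leibler divergence in nats. It is meaningful only when `q` is absolutely continuous
with respect to `r`, because `log 0 = 0`. -/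
def divergence (q r : S → ℝ) : ℝ :=
  crossEntropy q r - massEntropy q

theorem entropy_eq_massEntropy_div_log {q : S → ℝ} (hq : ∑ s, q s = 1) :
    entropy q = massEntropy q / log 2 := by
  simp only [entropy, massEntropy, hq, log_one, zero_sub, mul_neg, sum_neg_distrib, logb, neg_div,
    sum_div, mul_div_assoc]

theorem mul_log_sub_log_le_sub {a b : ℝ} (ha : 0 ≤ a) (hb : 0 ≤ b) (hab : b = 0 → a = 0) :
    a * (log b - log a) ≤ b - a := by
  rcases ha.eq_or_lt with rfl | ha
  · simpa using hb
  have hb : 0 < b := hb.lt_of_ne' fun h => ha.ne' (hab h)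
  calc a * (log b - log a) = a * log (b / a) := by rw [log_div hb.ne' ha.ne']
    _ ≤ a * (b / a - 1) := by gcongr; exact log_le_sub_one_of_pos (by positivity)
    _ = b - a := by field_simp

theorem sq_sqrt_sub_sqrt_le {a b : ℝ} (ha : 0 ≤ a) (hb : 0 ≤ b) (hab : b = 0 → a = 0) :
    (√a - √b) ^ 2 ≤ a * (log a - log b) - a + b := by
  have hlog : a * (log a - log b) = -2 * √a * (√a * (log √b - log √a)) := by
    rw [log_sqrt ha, log_sqrt hb]
    linear_combination (log a - log b) * (mul_self_sqrt ha).symm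
  have hbound := mul_le_mul_of_nonneg_left (mul_log_sub_log_le_sub (sqrt_nonneg a) (sqrt_nonneg b)
    (by simpa [sqrt_eq_zero, ha, hb] using hab)) (sqrt_nonneg a)
  nlinarith [mul_self_sqrt ha, mul_self_sqrt hb]

theorem massEntropy_le_crossEntropy {q r : S → ℝ} (hq : ∀ s, 0 ≤ q s) (hr : ∀ s, 0 ≤ r s)
    (hqr : ∀ s, r s = 0 → q s = 0) (hr1 : ∑ s, r s ≤ 1) : massEntropy q ≤ crossEntropy q r := by
  set Z := ∑ s, q s with hZ
  have hZ0 : 0 ≤ Z := sum_nonneg fun s _ => hq s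
  have hterm (s : S) : q s * (log Z - log (q s) + log (r s)) ≤ Z * r s - q s := by
    by_cases hqs : q s = 0
    · simpa [hqs] using mul_nonneg hZ0 (hr s)
    have hrs : r s ≠ 0 := fun h => hqs (hqr s h)
    have hZs : Z ≠ 0 := fun h =>
      hqs ((sum_eq_zero_iff_of_nonneg fun s _ => hq s).1 h s (mem_univ s))
    have hlog : log Z - log (q s) + log (r s) = log (Z * r s) - log (q s) := by
      rw [log_mul hZs hrs]; ring
    rw [hlog]
    exact mul_log_sub_log_le_sub (hq s) (mul_nonneg hZ0 (hr s))
      fun h => absurd h (mul_ne_zero hZs hrs)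
  have hsum : massEntropy q - crossEntropy q r ≤ Z * ∑ s, r s - Z :=
    calc massEntropy q - crossEntropy q r = ∑ s, q s * (log Z - log (q s) + log (r s)) := by
          simp only [massEntropy, crossEntropy, mul_add, sum_add_distrib, sub_neg_eq_add, hZ]
      _ ≤ ∑ s, (Z * r s - q s) := sum_le_sum fun s _ => hterm s
      _ = Z * ∑ s, r s - Z := by rw [sum_sub_distrib, ← mul_sum]
  linarith [mul_le_of_le_one_right hZ0 hr1]

theorem divergence_nonneg {q r : S → ℝ} (hq : ∀ s, 0 ≤ q s) (hr : ∀ s, 0 ≤ r s)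
    (hqr : ∀ s, r s = 0 → q s = 0) (hr1 : ∑ s, r s ≤ 1) : 0 ≤ divergence q r :=
  sub_nonneg.2 (massEntropy_le_crossEntropy hq hr hqr hr1)

theorem massEntropy_const_mul {q : S → ℝ} (hq : ∀ s, 0 ≤ q s) (c : ℝ) :
    massEntropy (fun s => c * q s) = c * massEntropy q := by
  by_cases hc : c = 0
  · simp [hc, massEntropy]
  unfold massEntropy
  rw [mul_sum]
  refine sum_congr rfl fun s _ => ?_
  by_cases hqs : q s = 0
  · simp [hqs]
  have hsum : ∑ s, q s ≠ 0 := fun h =>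
    hqs ((sum_eq_zero_iff_of_nonneg fun s _ => hq s).1 h s (mem_univ s))
  rw [← mul_sum, log_mul hc hqs, log_mul hc hsum]; ring

theorem massEntropy_nonneg {q : S → ℝ} (hq : ∀ s, 0 ≤ q s) : 0 ≤ massEntropy q := by
  refine sum_nonneg fun s _ => ?_
  rcases (hq s).eq_or_lt with hqs | hqs
  · simp [← hqs]
  · exact mul_nonneg hqs.le
      (sub_nonneg.2 (log_le_log hqs (single_le_sum (fun i _ => hq i) (mem_univ s))))

theorem massEntropy_le_log_card {q : S → ℝ} (hq : q ∈ stdSimplex ℝ S) :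
    massEntropy q ≤ log (Fintype.card S) := by
  have : Nonempty S := by
    by_contra! hS
    simp [stdSimplex_of_isEmpty_index] at hq
  have hcard : (Fintype.card S : ℝ) ≠ 0 := by exact_mod_cast Fintype.card_ne_zero
  calc massEntropy q ≤ crossEntropy q (fun _ => (Fintype.card S : ℝ)⁻¹) :=
        massEntropy_le_crossEntropy hq.1 (fun _ => by positivity)
          (fun _ h => absurd h (inv_ne_zero hcard)) (by simp [hcard])
    _ = log (Fintype.card S) := by simp [crossEntropy, ← sum_mul, hq.2]

/-- By positive homogeneity this is the concavity of the entropy. -/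
theorem sum_massEntropy_le_massEntropy_sum {q : ι → S → ℝ} (hq : ∀ i s, 0 ≤ q i s) :
    ∑ i, massEntropy (q i) ≤ massEntropy (fun s => ∑ i, q i s) := by
  set Z := ∑ s, ∑ i, q i s with hZ
  have hq0 (s : S) : 0 ≤ ∑ i, q i s := sum_nonneg fun i _ => hq i s
  have hZ0 : 0 ≤ Z := sum_nonneg fun s _ => hq0 s
  have hsum_ne {i : ι} {s : S} (h : q i s ≠ 0) : ∑ i, q i s ≠ 0 := fun h0 =>
    h ((sum_eq_zero_iff_of_nonneg fun i _ => hq i s).1 h0 i (mem_univ i))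
  have hZ_ne {i : ι} {s : S} (h : q i s ≠ 0) : Z ≠ 0 := fun h0 =>
    hsum_ne h ((sum_eq_zero_iff_of_nonneg fun s _ => hq0 s).1 h0 s (mem_univ s))
  have hgibbs (i : ι) : massEntropy (q i) ≤ crossEntropy (q i) (fun s => (∑ i, q i s) / Z) :=
    massEntropy_le_crossEntropy (hq i) (fun s => div_nonneg (hq0 s) hZ0)
      (fun s h => by_contra fun h' => div_ne_zero (hsum_ne h') (hZ_ne h') h)
      (by rw [← sum_div]; exact div_self_le_one Z)
  refine (sum_le_sum fun i _ => hgibbs i).trans_eq ?_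
  simp only [crossEntropy, massEntropy, ← hZ, sum_mul, ← sum_neg_distrib]
  rw [sum_comm]
  refine sum_congr rfl fun s _ => sum_congr rfl fun i _ => ?_
  by_cases h : q i s = 0
  · simp [h]
  rw [log_div (hsum_ne h) (hZ_ne h)]; ring

/-- The chain rule: both sides are the entropy of the joint law `J`. -/
theorem massEntropy_add_sum_massEntropy_comm (J : S → T → ℝ) :
    massEntropy (fun s => ∑ t, J s t) + ∑ s, massEntropy (J s) =
      massEntropy (fun t => ∑ s, J s t) + ∑ t, massEntropy (fun s => J s t) := by
  simp only [massEntropy, mul_sub, sum_sub_distrib, ← sum_mul]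
  rw [sum_comm, sum_comm (f := fun s t => J s t * log (J s t))]
  ring

/-- Pinsker's inequality with a worse constant, by comparison with the Hellinger distance. -/
theorem sq_sub_le_four_mul_divergence {q r : S → ℝ} (hq : q ∈ stdSimplex ℝ S)
    (hr : r ∈ stdSimplex ℝ S) (hqr : ∀ s, r s = 0 → q s = 0) (s : S) :
    (q s - r s) ^ 2 ≤ 4 * divergence q r := by
  have hhellinger : ∑ s, (√(q s) - √(r s)) ^ 2 ≤ divergence q r := by
    refine (sum_le_sum fun s _ => sq_sqrt_sub_sqrt_le (hq.1 s) (hr.1 s) (hqr s)).trans_eq ?_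
    simp only [sum_add_distrib, sum_sub_distrib, mul_sub, hq.2, hr.2, divergence, crossEntropy,
      massEntropy, log_one, mul_zero, sum_const_zero]
    ring
  have hcoord := (single_le_sum (f := fun s => (√(q s) - √(r s)) ^ 2) (fun s _ => sq_nonneg _)
    (mem_univ s)).trans hhellinger
  have hsqrt {p : S → ℝ} (hp : p ∈ stdSimplex ℝ S) : √(p s) ≤ 1 :=
    sqrt_le_one.2 (mem_Icc_of_mem_stdSimplex hp s).2
  have hsum_sq : (√(q s) + √(r s)) ^ 2 ≤ 4 := by
    nlinarith [hsqrt hq, hsqrt hr, sqrt_nonneg (q s), sqrt_nonneg (r s)]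
  calc (q s - r s) ^ 2 = (√(q s) + √(r s)) ^ 2 * (√(q s) - √(r s)) ^ 2 := by
        rw [← mul_pow, ← sq_sub_sq, sq_sqrt (hq.1 s), sq_sqrt (hr.1 s)]
    _ ≤ 4 * divergence q r := by gcongr

end Entropy

section Marginal

variable {S ι : Type*} [Fintype S] [Fintype ι] [DecidableEq ι]

/-- The `i`-th marginal of a measure on a power of `S`. -/
def marginal (q : (ι → S) → ℝ) (i : ι) (s : S) : ℝ :=
  open Classical in ∑ x, if x i = s then q x else 0

theorem sum_marginal_mul (q : (ι → S) → ℝ) (i : ι) (f : S → ℝ) :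
    ∑ s, marginal q i s * f s = ∑ x, q x * f (x i) := by
  classical
  simp only [marginal, sum_mul]
  rw [sum_comm]
  simp

theorem sum_marginal (q : (ι → S) → ℝ) (i : ι) : ∑ s, marginal q i s = ∑ x, q x := by
  simpa using sum_marginal_mul q i 1

theorem marginal_nonneg {q : (ι → S) → ℝ} (hq : ∀ x, 0 ≤ q x) (i : ι) (s : S) :
    0 ≤ marginal q i s :=
  sum_nonneg fun x _ => by split_ifs <;> simp [hq]

theorem le_marginal {q : (ι → S) → ℝ} (hq : ∀ x, 0 ≤ q x) (i : ι) (x : ι → S) :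
    q x ≤ marginal q i (x i) := by
  classical
  simpa [marginal] using single_le_sum (f := fun y => if y i = x i then q y else 0)
    (fun y _ => by split_ifs <;> simp [hq]) (mem_univ x)

theorem sum_prod_apply (f : ι → S → ℝ) : ∑ x : ι → S, ∏ i, f i (x i) = ∏ i, ∑ s, f i s := by
  rw [Finset.prod_univ_sum, Fintype.piFinset_univ]

theorem prod_apply_mem_stdSimplex {p : ι → S → ℝ} (hp : ∀ i, p i ∈ stdSimplex ℝ S) :
    (fun x : ι → S => ∏ i, p i (x i)) ∈ stdSimplex ℝ (ι → S) :=
  ⟨fun _ => prod_nonneg fun _ _ => (hp _).1 _, by simp [sum_prod_apply p, (hp _).2]⟩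

theorem marginal_prod {p : ι → S → ℝ} (hp : ∀ i, p i ∈ stdSimplex ℝ S) (i : ι) :
    marginal (fun x => ∏ j, p j (x j)) i = p i := by
  classical
  funext s
  have hrestrict (x : ι → S) : (if x i = s then ∏ j, p j (x j) else 0) =
      ∏ j, if j = i then (if x j = s then p j (x j) else 0) else p j (x j) := by
    split_ifs with h
    · refine prod_congr rfl fun j _ => ?_
      by_cases hj : j = i
      · subst hj; simp [h]
      · simp [hj]
    · exact (prod_eq_zero (mem_univ i) (by simp [h])).symm
  simp only [marginal, hrestrict]
  rw [sum_prod_apply (fun j s' => if j = i then (if s' = s then p j s' else 0) else p j s'),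
    prod_eq_single i]
  · simp
  · intro j _ hj
    simp [hj, (hp j).2]
  · simp

/-- Subadditivity of the entropy: Gibbs' inequality against the product of the marginals. -/
theorem massEntropy_le_sum_massEntropy_marginal {q : (ι → S) → ℝ} (hq : ∀ x, 0 ≤ q x) :
    massEntropy q ≤ ∑ i, massEntropy (marginal q i) := by
  set Z := ∑ x, q x with hZ
  have hZ0 : 0 ≤ Z := sum_nonneg fun x _ => hq x
  have hZ_ne {x : ι → S} (h : q x ≠ 0) : Z ≠ 0 := fun h0 =>
    h ((sum_eq_zero_iff_of_nonneg fun x _ => hq x).1 h0 x (mem_univ x))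
  have hmarginal_ne {x : ι → S} (i : ι) (h : q x ≠ 0) : marginal q i (x i) ≠ 0 :=
    (((hq x).lt_of_ne' h).trans_le (le_marginal hq i x)).ne'
  have hgibbs : massEntropy q ≤ crossEntropy q fun x => ∏ i, marginal q i (x i) / Z := by
    refine massEntropy_le_crossEntropy hq
      (fun x => prod_nonneg fun i _ => div_nonneg (marginal_nonneg hq _ _) hZ0)
      (fun x h => by_contra fun h' =>
        prod_ne_zero_iff.2 (fun i _ => div_ne_zero (hmarginal_ne i h') (hZ_ne h')) h) ?_
    rw [sum_prod_apply (fun i s => marginal q i s / Z)]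
    refine prod_le_one
      (fun i _ => sum_nonneg fun s _ => div_nonneg (marginal_nonneg hq _ _) hZ0) fun i _ => ?_
    rw [← sum_div, sum_marginal]
    exact div_self_le_one Z
  refine hgibbs.trans_eq ?_
  simp only [massEntropy, sum_marginal, ← hZ, crossEntropy,
    sum_marginal_mul q _ (fun s => log Z - log (marginal q _ s))]
  rw [sum_comm, ← sum_neg_distrib]
  refine sum_congr rfl fun x _ => ?_
  by_cases h : q x = 0
  · simp [h]
  rw [log_prod fun i _ => div_ne_zero (hmarginal_ne i h) (hZ_ne h), ← mul_sum, ← mul_neg,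
    ← sum_neg_distrib]
  congr! 2 with i
  rw [log_div (hmarginal_ne i h) (hZ_ne h), neg_sub]

theorem massEntropy_prod {p : ι → S → ℝ} (hp : ∀ i, p i ∈ stdSimplex ℝ S) :
    massEntropy (fun x : ι → S => ∏ i, p i (x i)) = ∑ i, massEntropy (p i) := by
  have hcoord (i : ι) :
      massEntropy (p i) = ∑ x : ι → S, (∏ j, p j (x j)) * -log (p i (x i)) := by
    rw [← sum_marginal_mul (fun x => ∏ j, p j (x j)) i (fun s => -log (p i s)), marginal_prod hp]
    simp [massEntropy, (hp i).2]
  simp only [hcoord]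
  rw [sum_comm]
  simp only [massEntropy, (prod_apply_mem_stdSimplex hp).2]
  refine sum_congr rfl fun x _ => ?_
  by_cases h : ∏ i, p i (x i) = 0
  · simp [h]
  rw [log_prod fun i hi h0 => h (prod_eq_zero hi h0), ← mul_sum, log_one, zero_sub,
    sum_neg_distrib]

end Marginal

section WeakLaw

variable {S : Type*} [Fintype S] {p : S → ℝ}

theorem iidLaw_mem_stdSimplex (hp : p ∈ stdSimplex ℝ S) {n : ℕ} :
    (iidLaw p : (Fin n → S) → ℝ) ∈ stdSimplex ℝ (Fin n → S) :=
  prod_apply_mem_stdSimplex fun _ => hp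

theorem marginal_iidLaw (hp : p ∈ stdSimplex ℝ S) {n : ℕ} (t : Fin n) :
    marginal (iidLaw p) t = p :=
  marginal_prod (fun _ => hp) t

theorem massEntropy_iidLaw (hp : p ∈ stdSimplex ℝ S) {n : ℕ} :
    massEntropy (iidLaw p : (Fin n → S) → ℝ) = n * massEntropy p := by
  have hprod : massEntropy (iidLaw p : (Fin n → S) → ℝ) = _ := massEntropy_prod fun _ => hp
  simpa using hprod

theorem sum_iidLaw_mul_sum (hp : p ∈ stdSimplex ℝ S) (f : S → ℝ) (n : ℕ) :
    ∑ x : Fin n → S, iidLaw p x * ∑ t, f (x t) = n * ∑ s, p s * f s := by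
  simp only [mul_sum]
  rw [sum_comm]
  simp [← sum_marginal_mul, marginal_iidLaw hp, ← mul_sum]

theorem sum_iidLaw_mul_sum_sq (hp : p ∈ stdSimplex ℝ S) {g : S → ℝ}
    (hg : ∑ s, p s * g s = 0) (n : ℕ) :
    ∑ x : Fin n → S, iidLaw p x * (∑ t, g (x t)) ^ 2 = n * ∑ s, p s * g s ^ 2 := by
  induction n with
  | zero => simp
  | succ n ih =>
    have hexpand (s : S) (x : Fin n → S) :
        iidLaw p (Fin.cons s x : Fin (n + 1) → S) *
          (∑ t, g ((Fin.cons s x : Fin (n + 1) → S) t)) ^ 2 =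
        p s * g s ^ 2 * iidLaw p x + p s * g s * (2 * (iidLaw p x * ∑ t, g (x t))) +
          p s * (iidLaw p x * (∑ t, g (x t)) ^ 2) := by
      simp only [iidLaw, Fin.prod_univ_succ, Fin.sum_univ_succ, Fin.cons_zero, Fin.cons_succ]
      ring
    calc _ = ∑ s, ∑ x : Fin n → S, iidLaw p (Fin.cons s x : Fin (n + 1) → S) *
          (∑ t, g ((Fin.cons s x : Fin (n + 1) → S) t)) ^ 2 := by
          rw [← (Fin.consEquiv fun _ => S).sum_comp, Fintype.sum_prod_type]; rfl
      _ = _ := ?_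
    simp only [hexpand, sum_add_distrib, ← mul_sum, ← sum_mul, ih, hg, hp.2,
      (iidLaw_mem_stdSimplex hp).2]
    push_cast
    ring

open scoped Classical in
theorem sum_iidLaw_deviation_mul_sq_le (hp : p ∈ stdSimplex ℝ S) {g : S → ℝ}
    (hg : ∑ s, p s * g s = 0) {c : ℝ} (hc : 0 ≤ c) (n : ℕ) :
    (∑ x : Fin n → S with c ≤ |∑ t, g (x t)|, iidLaw p x) * c ^ 2 ≤ n * ∑ s, p s * g s ^ 2 := by
  rw [← sum_iidLaw_mul_sum_sq hp hg n, sum_mul]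
  refine (sum_le_sum fun x hx => ?_).trans (sum_le_univ_sum_of_nonneg fun x =>
    mul_nonneg ((iidLaw_mem_stdSimplex hp).1 x) (sq_nonneg (∑ t, g (x t))))
  rw [← sq_abs (∑ t, g (x t))]
  exact mul_le_mul_of_nonneg_left (pow_le_pow_left₀ hc (mem_filter.1 hx).2 2)
    ((iidLaw_mem_stdSimplex hp).1 x)

open scoped Classical in
theorem eventually_sum_iidLaw_deviation_le (hp : p ∈ stdSimplex ℝ S) (f : S → ℝ)
    {ε δ : ℝ} (hε : 0 < ε) (hδ : 0 < δ) :
    ∀ᶠ n : ℕ in atTop, ∑ x : Fin n → S with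
      n * ε ≤ |∑ t, f (x t) - n * ∑ s, p s * f s|, iidLaw p x ≤ δ := by
  set E := ∑ s, p s * f s with hE
  set v := ∑ s, p s * (f s - E) ^ 2
  have hcentered : ∑ s, p s * (f s - E) = 0 := by
    simp only [mul_sub, sum_sub_distrib, ← sum_mul, hp.2, ← hE]; ring
  filter_upwards [eventually_gt_atTop 0,
    tendsto_natCast_atTop_atTop.eventually_ge_atTop (v / (ε ^ 2 * δ))] with n hn hvn
  have hn : (0 : ℝ) < n := by exact_mod_cast hn
  rw [div_le_iff₀ (by positivity)] at hvn
  have hchebyshev := sum_iidLaw_deviation_mul_sq_le hp hcentered (c := n * ε) (by positivity) n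
  simp only [sum_sub_distrib, sum_const, card_univ, Fintype.card_fin, nsmul_eq_mul] at hchebyshev
  refine le_of_mul_le_mul_right (hchebyshev.trans ?_) (show 0 < (n * ε) ^ 2 by positivity)
  calc n * v ≤ n * (n * (ε ^ 2 * δ)) := by gcongr
    _ = δ * (n * ε) ^ 2 := by ring

theorem exists_le_of_le_sum_mul (hp : p ∈ stdSimplex ℝ S) {f : S → ℝ} {c : ℝ}
    (h : c ≤ ∑ s, p s * f s) : ∃ s, c ≤ f s := by
  by_contra! hlt
  obtain ⟨s, hs⟩ : ∃ s, 0 < p s := by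
    by_contra! hp0
    linarith [hp.2, sum_nonpos fun s (_ : s ∈ univ) => hp0 s]
  have : ∑ s, p s * f s < ∑ s, p s * c :=
    sum_lt_sum (fun s _ => mul_le_mul_of_nonneg_left (hlt s).le (hp.1 s))
      ⟨s, mem_univ s, mul_lt_mul_of_pos_left (hlt s) hs⟩
  rw [← sum_mul, hp.2, one_mul] at this
  exact h.not_gt this

end WeakLaw

section OneShotCoding

variable {X Y : Type*} [Fintype X] [Fintype Y] {p : X → ℝ} {W : X → Y → ℝ}

/-- The law of the output of the channel `W` when its input has law `p`. -/
def outputLaw {X Y : Type*} [Fintype X] (p : X → ℝ) (W : X → Y → ℝ) (y : Y) : ℝ :=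
  ∑ x, p x * W x y

theorem outputLaw_mem_stdSimplex (hp : p ∈ stdSimplex ℝ X) (hW : ∀ x, W x ∈ stdSimplex ℝ Y) :
    outputLaw p W ∈ stdSimplex ℝ Y := by
  refine ⟨fun y => sum_nonneg fun x _ => mul_nonneg (hp.1 x) ((hW x).1 y), ?_⟩
  simp only [outputLaw]
  rw [sum_comm]
  simp [← mul_sum, (hW _).2, hp.2]

theorem sum_filter_le_sum_filter_of_imp {w : Y → ℝ} (hw : ∀ y, 0 ≤ w y) {B B' : Y → Prop}
    [DecidablePred B] [DecidablePred B'] (h : ∀ y, w y ≠ 0 → B y → B' y) :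
    ∑ y with B y, w y ≤ ∑ y with B' y, w y := by
  simp only [sum_filter]
  refine sum_le_sum fun y _ => ?_
  by_cases hwy : w y = 0
  · simp [hwy]
  · by_cases hB : B y
    · simp [hB, h y hwy hB]
    · simp only [hB, if_false]
      split_ifs <;> simp [hw]

theorem sum_filter_or_le {w : Y → ℝ} (hw : ∀ y, 0 ≤ w y) (B B' : Y → Prop) [DecidablePred B]
    [DecidablePred B'] :
    ∑ y with B y ∨ B' y, w y ≤ ∑ y with B y, w y + ∑ y with B' y, w y := by
  classical
  rw [filter_or, ← sum_union_inter]
  exact le_add_of_nonneg_right (sum_nonneg fun y _ => hw y)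

open scoped Classical in
theorem exists_input_avoiding (hp : p ∈ stdSimplex ℝ X) (hW : ∀ x, W x ∈ stdSimplex ℝ Y) {γ ε : ℝ}
    (U : Finset Y)
    (h : ∑ y ∈ U, outputLaw p W y +
      ∑ x, ∑ y with W x y ≤ γ * outputLaw p W y, p x * W x y ≤ ε) :
    ∃ x, 1 - ε ≤ ∑ y with γ * outputLaw p W y < W x y ∧ y ∉ U, W x y := by
  refine exists_le_of_le_sum_mul hp ?_
  have hunion (x : X) : p x * 1 ≤ p x * ∑ y with γ * outputLaw p W y < W x y ∧ y ∉ U, W x y +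
      ∑ y ∈ U, p x * W x y + ∑ y with W x y ≤ γ * outputLaw p W y, p x * W x y := by
    rw [← (hW x).2, ← filter_mem_eq_inter.trans (univ_inter U)]
    simp only [mul_sum, sum_filter, ← sum_add_distrib]
    refine sum_le_sum fun y _ => ?_
    have hmass := mul_nonneg (hp.1 x) ((hW x).1 y)
    by_cases hγ : W x y ≤ γ * outputLaw p W y <;> by_cases hU : y ∈ U <;>
      simp [hγ, hU, hmass, ← not_le]
  have hsum := sum_le_sum fun x (_ : x ∈ univ) => hunion x
  simp only [mul_one, hp.2, sum_add_distrib] at hsum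
  rw [sum_comm (t := U)] at hsum
  simp only [outputLaw] at h hsum ⊢
  linarith

open scoped Classical in
/-- Feinstein's lemma: codewords and decoding sets are chosen greedily, since the decoding sets
chosen so far have small probability under the output law. -/
theorem exists_disjoint_decoding_sets (hp : p ∈ stdSimplex ℝ X) (hW : ∀ x, W x ∈ stdSimplex ℝ Y)
    {γ ε : ℝ} (hγ : 0 < γ) (M : ℕ)
    (h : M / γ + ∑ x, ∑ y with W x y ≤ γ * outputLaw p W y, p x * W x y ≤ ε) :
    ∃ (c : Fin M → X) (D : Fin M → Finset Y), Pairwise (Function.onFun Disjoint D) ∧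
      (∀ i, ∀ y ∈ D i, γ * outputLaw p W y < W (c i) y) ∧ ∀ i, 1 - ε ≤ ∑ y ∈ D i, W (c i) y := by
  induction M with
  | zero => exact ⟨Fin.elim0, Fin.elim0, fun i => i.elim0, fun i => i.elim0, fun i => i.elim0⟩
  | succ M ih =>
    have hM : (M : ℝ) / γ ≤ (M + 1 : ℕ) / γ := by gcongr; simp
    obtain ⟨c, D, hdisj, hthreshold, hcorrect⟩ := ih (by linarith)
    have hD (i : Fin M) : ∑ y ∈ D i, outputLaw p W y ≤ 1 / γ := by
      rw [le_div_iff₀ hγ, sum_mul]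
      calc ∑ y ∈ D i, outputLaw p W y * γ ≤ ∑ y ∈ D i, W (c i) y :=
            sum_le_sum fun y hy => by linarith [hthreshold i y hy]
        _ ≤ ∑ y, W (c i) y := sum_le_univ_sum_of_nonneg (hW (c i)).1
        _ = 1 := (hW (c i)).2
    have hused : ∑ y ∈ univ.biUnion D, outputLaw p W y ≤ M / γ := by
      rw [sum_biUnion fun i _ j _ hij => hdisj hij]
      exact (sum_le_sum fun i _ => hD i).trans_eq (by simp [div_eq_mul_inv])
    obtain ⟨x, hx⟩ := exists_input_avoiding hp hW (γ := γ) (ε := ε) (univ.biUnion D) (by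
      rw [Nat.cast_succ, add_div] at h
      linarith [one_div_nonneg.2 hγ.le])
    set E : Finset Y := {y | γ * outputLaw p W y < W x y ∧ y ∉ univ.biUnion D}
    have hDE (i : Fin M) : Disjoint (D i) E := disjoint_left.2 fun y hy hyE =>
      (mem_filter.1 hyE).2.2 (mem_biUnion.2 ⟨i, mem_univ i, hy⟩)
    refine ⟨Fin.snoc c x, Fin.snoc D E, fun i j hij => ?_, Fin.lastCases ?_ ?_,
      Fin.lastCases ?_ ?_⟩
    · induction i using Fin.lastCases <;> induction j using Fin.lastCases
      · exact absurd rfl hij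
      · simpa [Function.onFun] using (hDE _).symm
      · simpa [Function.onFun] using hDE _
      · simpa [Function.onFun] using hdisj fun h => hij (congrArg Fin.castSucc h)
    · simp only [Fin.snoc_last]
      exact fun y hy => (mem_filter.1 hy).2.1
    · simpa using hthreshold
    · simpa using hx
    · simpa using hcorrect

open scoped Classical in
theorem exists_code {I : Type*} [Fintype I] [Nonempty I] [DecidableEq I]
    (hp : p ∈ stdSimplex ℝ X) (hW : ∀ x, W x ∈ stdSimplex ℝ Y) {γ ε : ℝ} (hγ : 0 < γ)
    (h : Fintype.card I / γ + ∑ x, ∑ y with W x y ≤ γ * outputLaw p W y, p x * W x y ≤ ε) :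
    ∃ (c : I → X) (d : Y → I), ∀ i, ∑ y with d y ≠ i, W (c i) y ≤ ε := by
  obtain ⟨c, D, hdisj, -, hcorrect⟩ := exists_disjoint_decoding_sets hp hW hγ _ h
  let e := Fintype.equivFin I
  let d (y : Y) : I :=
    if hy : ∃ i, y ∈ D (e i) then hy.choose else Classical.arbitrary I
  have hd {i : I} {y : Y} (hy : y ∈ D (e i)) : d y = i := by
    have hex : ∃ i, y ∈ D (e i) := ⟨i, hy⟩
    simp only [d, dif_pos hex]
    by_contra hne
    exact disjoint_left.1 (hdisj fun h => hne (e.injective h)) hex.choose_spec hy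
  refine ⟨c ∘ e, d, fun i => ?_⟩
  have hsub : univ.filter (d · ≠ i) ⊆ (D (e i))ᶜ := fun y hy =>
    mem_compl.2 fun hyD => (mem_filter.1 hy).2 (hd hyD)
  calc ∑ y with d y ≠ i, W (c (e i)) y ≤ ∑ y ∈ (D (e i))ᶜ, W (c (e i)) y :=
        sum_le_sum_of_subset_of_nonneg hsub fun y _ _ => (hW _).1 y
    _ = 1 - ∑ y ∈ D (e i), W (c (e i)) y := by
        rw [← (hW (c (e i))).2, ← sum_add_sum_compl (D (e i)), add_sub_cancel_left]
    _ ≤ ε := by linarith [hcorrect (e i)]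

theorem exists_input_covering (hp : p ∈ stdSimplex ℝ X) (hW : ∀ x, W x ∈ stdSimplex ℝ Y)
    {G : X → Y → Prop} [∀ x, DecidablePred (G x)] {γ : ℝ} (hγ : 0 < γ)
    (hG : ∀ x y, p x ≠ 0 → G x y → W x y ≤ γ * outputLaw p W y) (R : Y → Prop) [DecidablePred R] :
    ∃ x, (∑ y with R y, outputLaw p W y - ∑ x, ∑ y with ¬G x y, p x * W x y) / γ ≤
      ∑ y with R y ∧ G x y, outputLaw p W y := by
  refine exists_le_of_le_sum_mul hp ?_
  rw [div_le_iff₀ hγ, sub_le_iff_le_add]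
  have hW0 (x : X) (y : Y) : 0 ≤ p x * W x y := mul_nonneg (hp.1 x) ((hW x).1 y)
  have hcover (x : X) (y : Y) : (if R y then p x * W x y else 0) ≤
      p x * (if R y ∧ G x y then outputLaw p W y else 0) * γ +
        if ¬G x y then p x * W x y else 0 := by
    by_cases hR : R y <;> by_cases hGxy : G x y <;> simp only [hR, hGxy, if_true, if_false,
      true_and, false_and, not_true, not_false_eq_true, mul_zero, zero_mul, zero_add, add_zero,
      le_refl, hW0]
    by_cases hpx : p x = 0
    · simp [hpx]
    · linarith [mul_le_mul_of_nonneg_left (hG x y hpx hGxy) (hp.1 x)]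
  calc ∑ y with R y, outputLaw p W y = ∑ x, ∑ y, if R y then p x * W x y else 0 := by
        rw [sum_comm, sum_filter]
        refine sum_congr rfl fun y _ => ?_
        split_ifs <;> simp [outputLaw]
    _ ≤ ∑ x, ∑ y, (p x * (if R y ∧ G x y then outputLaw p W y else 0) * γ +
          if ¬G x y then p x * W x y else 0) :=
        sum_le_sum fun x _ => sum_le_sum fun y _ => hcover x y
    _ = _ := by simp only [sum_add_distrib, sum_filter, mul_sum, sum_mul]

/-- Covering lemma: each greedily chosen word covers a fraction `1 / γ` of the coverable outputs
that remain uncovered. -/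
theorem exists_covering_words (hp : p ∈ stdSimplex ℝ X) (hW : ∀ x, W x ∈ stdSimplex ℝ Y)
    {G : X → Y → Prop} [∀ x, DecidablePred (G x)] {γ : ℝ} (hγ : 1 ≤ γ)
    (hG : ∀ x y, p x ≠ 0 → G x y → W x y ≤ γ * outputLaw p W y) (M : ℕ) :
    ∃ c : Fin M → X, ∑ y with (∀ i, ¬G (c i) y), outputLaw p W y ≤
      ∑ x, ∑ y with ¬G x y, p x * W x y + (1 - 1 / γ) ^ M := by
  have hγ0 : 0 < γ := zero_lt_one.trans_le hγ
  set g := ∑ x, ∑ y with ¬G x y, p x * W x y with hg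
  induction M with
  | zero =>
    have hg0 : 0 ≤ g := sum_nonneg fun x _ => sum_nonneg fun y _ =>
      mul_nonneg (hp.1 x) ((hW x).1 y)
    refine ⟨Fin.elim0, ?_⟩
    simpa [(outputLaw_mem_stdSimplex hp hW).2] using hg0
  | succ M ih =>
    obtain ⟨c, hc⟩ := ih
    obtain ⟨x, hx⟩ := exists_input_covering hp hW hγ0 hG fun y => ∀ i, ¬G (c i) y
    rw [← hg] at hx
    have hsplit : ∑ y with (∀ i, ¬G ((Fin.snoc c x : Fin (M + 1) → X) i) y), outputLaw p W y +
        ∑ y with (∀ i, ¬G (c i) y) ∧ G x y, outputLaw p W y =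
        ∑ y with (∀ i, ¬G (c i) y), outputLaw p W y := by
      simp only [sum_filter, ← sum_add_distrib, Fin.forall_fin_succ', Fin.snoc_castSucc,
        Fin.snoc_last]
      refine sum_congr rfl fun y _ => ?_
      by_cases hxy : G x y <;> simp [hxy]
    have hfactor : 0 ≤ 1 - 1 / γ := sub_nonneg.2 ((div_le_one hγ0).2 hγ)
    refine ⟨Fin.snoc c x, ?_⟩
    have hstep := mul_le_mul_of_nonneg_right (sub_le_iff_le_add'.2 hc) hfactor
    rw [pow_succ]
    rw [mul_one_sub, mul_one_div] at hstep
    linarith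

end OneShotCoding

section BlockCoding

variable {X Y : Type*} [Fintype X] [Fintype Y] {p : X → ℝ} {Q : X → Y → ℝ}

/-- Mutual information, in nats, between the input and the output of the channel `Q` when the
input has law `p`. -/
def mutualInfoNat (p : X → ℝ) (Q : X → Y → ℝ) : ℝ :=
  massEntropy (outputLaw p Q) - ∑ x, p x * massEntropy (Q x)

/-- The information density: the log-likelihood ratio of the output `y` under the input `x` and
under the output law. Its mean is the mutual information. -/
def infoDensity (p : X → ℝ) (Q : X → Y → ℝ) (x : X) (y : Y) : ℝ :=
  log (Q x y) - log (outputLaw p Q y)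

theorem mutualInfoNat_nonneg (hp : p ∈ stdSimplex ℝ X) (hQ : ∀ x, Q x ∈ stdSimplex ℝ Y) :
    0 ≤ mutualInfoNat p Q := by
  have hconcave := sum_massEntropy_le_massEntropy_sum (q := fun x y => p x * Q x y) fun x y =>
    mul_nonneg (hp.1 x) ((hQ x).1 y)
  simp only [massEntropy_const_mul (hQ _).1] at hconcave
  exact sub_nonneg.2 hconcave

theorem sum_mul_infoDensity (hp : p ∈ stdSimplex ℝ X) (hQ : ∀ x, Q x ∈ stdSimplex ℝ Y) :
    ∑ x, p x * ∑ y, Q x y * infoDensity p Q x y = mutualInfoNat p Q := by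
  have hout : ∑ x, ∑ y, p x * (Q x y * log (outputLaw p Q y)) =
      ∑ y, outputLaw p Q y * log (outputLaw p Q y) := by
    rw [sum_comm]
    simp only [outputLaw, sum_mul, mul_assoc]
  simp only [infoDensity, mul_sub, sum_sub_distrib, mutualInfoNat, massEntropy, (hQ _).2,
    (outputLaw_mem_stdSimplex hp hQ).2, log_one, zero_sub, mul_neg, mul_sum, sum_neg_distrib, hout]
  ring

theorem channelPow_mem_stdSimplex {X : Type*} {Q : X → Y → ℝ} (hQ : ∀ x, Q x ∈ stdSimplex ℝ Y)
    {k : ℕ} (x : Fin k → X) : channelPow Q x ∈ stdSimplex ℝ (Fin k → Y) :=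
  prod_apply_mem_stdSimplex (p := fun t => Q (x t)) fun t => hQ (x t)

theorem outputLaw_channelPow {Y : Type*} {Q : X → Y → ℝ} {k : ℕ} (y : Fin k → Y) :
    outputLaw (iidLaw p : (Fin k → X) → ℝ) (channelPow Q) y = iidLaw (outputLaw p Q) y := by
  simp only [outputLaw, iidLaw, channelPow, ← prod_mul_distrib]
  exact sum_prod_apply fun t x => p x * Q x (y t)

theorem iidLaw_mul_channelPow_nonneg (hp : p ∈ stdSimplex ℝ X) (hQ : ∀ x, Q x ∈ stdSimplex ℝ Y)
    {k : ℕ} (x : Fin k → X) (y : Fin k → Y) : 0 ≤ iidLaw p x * channelPow Q x y :=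
  mul_nonneg ((iidLaw_mem_stdSimplex hp).1 x) ((channelPow_mem_stdSimplex hQ x).1 y)

theorem sum_sum_iidLaw_mul_channelPow_mul {k : ℕ} (G : (Fin k → X × Y) → ℝ) :
    ∑ x : Fin k → X, ∑ y : Fin k → Y, iidLaw p x * channelPow Q x y * G (fun t => (x t, y t)) =
      ∑ z, iidLaw (fun z : X × Y => p z.1 * Q z.1 z.2) z * G z := by
  rw [← (Equiv.arrowProdEquivProdArrow (Fin k) (fun _ => X) (fun _ => Y)).symm.sum_comp,
    Fintype.sum_prod_type]
  refine sum_congr rfl fun x _ => sum_congr rfl fun y _ => ?_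
  simp [Equiv.arrowProdEquivProdArrow, iidLaw, channelPow, prod_mul_distrib]

open scoped Classical in
theorem eventually_sum_sum_deviation_le (hp : p ∈ stdSimplex ℝ X)
    (hQ : ∀ x, Q x ∈ stdSimplex ℝ Y) (F : X → Y → ℝ) {ε δ : ℝ} (hε : 0 < ε) (hδ : 0 < δ) :
    ∀ᶠ k : ℕ in atTop, ∑ x : Fin k → X, ∑ y : Fin k → Y with
      k * ε ≤ |∑ t, F (x t) (y t) - k * ∑ x, p x * ∑ y, Q x y * F x y|,
        iidLaw p x * channelPow Q x y ≤ δ := by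
  have hjoint : (fun z : X × Y => p z.1 * Q z.1 z.2) ∈ stdSimplex ℝ (X × Y) := by
    refine ⟨fun z => mul_nonneg (hp.1 _) ((hQ _).1 _), ?_⟩
    rw [Fintype.sum_prod_type]
    simp [← mul_sum, (hQ _).2, hp.2]
  have hmean : ∑ z : X × Y, p z.1 * Q z.1 z.2 * F z.1 z.2 =
      ∑ x, p x * ∑ y, Q x y * F x y := by
    rw [Fintype.sum_prod_type]
    simp only [mul_sum, mul_assoc]
  filter_upwards [eventually_sum_iidLaw_deviation_le hjoint (fun z => F z.1 z.2) hε hδ] with k hk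
  rw [hmean] at hk
  refine hk.trans' (le_of_eq ?_)
  simpa [sum_filter] using sum_sum_iidLaw_mul_channelPow_mul (p := p) (Q := Q) fun z =>
    if k * ε ≤ |∑ t, F (z t).1 (z t).2 - k * ∑ x, p x * ∑ y, Q x y * F x y| then 1 else 0

theorem outputLaw_pos (hp : p ∈ stdSimplex ℝ X) (hQ : ∀ x, Q x ∈ stdSimplex ℝ Y) {x : X} {y : Y}
    (hx : p x ≠ 0) (hxy : Q x y ≠ 0) : 0 < outputLaw p Q y :=
  (mul_pos ((hp.1 x).lt_of_ne' hx) (((hQ x).1 y).lt_of_ne' hxy)).trans_le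
    (single_le_sum (f := fun x => p x * Q x y)
      (fun x _ => mul_nonneg (hp.1 x) ((hQ x).1 y)) (mem_univ x))

theorem channelPow_eq_exp_sum_infoDensity_mul (hp : p ∈ stdSimplex ℝ X)
    (hQ : ∀ x, Q x ∈ stdSimplex ℝ Y) {k : ℕ} {x : Fin k → X} {y : Fin k → Y}
    (hx : iidLaw p x ≠ 0) (hxy : channelPow Q x y ≠ 0) :
    channelPow Q x y =
      exp (∑ t, infoDensity p Q (x t) (y t)) * outputLaw (iidLaw p) (channelPow Q) y := by
  rw [outputLaw_channelPow]
  simp only [channelPow, iidLaw, exp_sum, ← prod_mul_distrib]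
  refine prod_congr rfl fun t _ => ?_
  have hQt := prod_ne_zero_iff.1 hxy t (mem_univ t)
  have hout := outputLaw_pos hp hQ (prod_ne_zero_iff.1 hx t (mem_univ t)) hQt
  rw [infoDensity, exp_sub, exp_log (((hQ _).1 _).lt_of_ne' hQt), exp_log hout,
    div_mul_cancel₀ _ hout.ne']

theorem eventually_exp_neg_mul_le {δ ε : ℝ} (hδ : 0 < δ) (hε : 0 < ε) :
    ∀ᶠ n : ℕ in atTop, exp (-(n * δ)) ≤ ε :=
  (tendsto_exp_neg_atTop_nhds_zero.comp
    (tendsto_natCast_atTop_atTop.atTop_mul_const hδ)).eventually_le_const hε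

open scoped Classical in
theorem eventually_exists_channel_code (hp : p ∈ stdSimplex ℝ X) (hQ : ∀ x, Q x ∈ stdSimplex ℝ Y)
    {R ε : ℝ} (hR : R < mutualInfoNat p Q) (hε : 0 < ε) :
    ∀ᶠ k : ℕ in atTop, ∀ (I : Type*) [Fintype I] [Nonempty I] [DecidableEq I],
      (Fintype.card I : ℝ) ≤ exp (k * R) → ∃ (c : I → Fin k → X) (d : (Fin k → Y) → I),
        ∀ i, ∑ y with d y ≠ i, channelPow Q (c i) y ≤ ε := by
  obtain ⟨δ, hδ⟩ : ∃ δ, δ = (mutualInfoNat p Q - R) / 2 := ⟨_, rfl⟩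
  have hδ0 : 0 < δ := by linarith
  filter_upwards [eventually_exp_neg_mul_le hδ0 (half_pos hε), eventually_gt_atTop 0,
    eventually_sum_sum_deviation_le hp hQ (infoDensity p Q) (half_pos hδ0) (half_pos hε)]
    with k hexp hk htypical I _ _ _ hI
  have hk : (0 : ℝ) < k := by exact_mod_cast hk
  rw [sum_mul_infoDensity hp hQ] at htypical
  refine exists_code (iidLaw_mem_stdSimplex hp) (channelPow_mem_stdSimplex hQ)
    (exp_pos (k * (R + δ))) ?_
  have hrate : (Fintype.card I : ℝ) / exp (k * (R + δ)) ≤ ε / 2 := by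
    rw [div_le_iff₀ (exp_pos _)]
    calc (Fintype.card I : ℝ) ≤ exp (-(k * δ)) * exp (k * (R + δ)) := by
          rw [← exp_add]; convert hI using 2; ring
      _ ≤ ε / 2 * exp (k * (R + δ)) := by gcongr
  have hatypical : ∑ x : Fin k → X, ∑ y with channelPow Q x y ≤
      exp (k * (R + δ)) * outputLaw (iidLaw p) (channelPow Q) y,
        iidLaw p x * channelPow Q x y ≤ ε / 2 := by
    refine htypical.trans' (sum_le_sum fun x _ =>
      sum_filter_le_sum_filter_of_imp (iidLaw_mul_channelPow_nonneg hp hQ x) fun y hmass hle => ?_)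
    rw [channelPow_eq_exp_sum_infoDensity_mul hp hQ (left_ne_zero_of_mul hmass)
      (right_ne_zero_of_mul hmass)] at hle
    have hout : 0 < outputLaw (iidLaw p) (channelPow Q) y :=
      outputLaw_pos (iidLaw_mem_stdSimplex hp) (channelPow_mem_stdSimplex hQ)
        (left_ne_zero_of_mul hmass) (right_ne_zero_of_mul hmass)
    have hdensity := exp_le_exp.1 (le_of_mul_le_mul_right hle hout)
    have hRδ : (k : ℝ) * (R + δ) = k * mutualInfoNat p Q - k * δ := by rw [hδ]; ring
    rw [le_abs']
    left
    linarith [mul_pos hk hδ0]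
  linarith

theorem channelPow_le_exp_mul_outputLaw (hp : p ∈ stdSimplex ℝ X)
    (hQ : ∀ x, Q x ∈ stdSimplex ℝ Y) {k : ℕ} {x : Fin k → X} {y : Fin k → Y} {s : ℝ}
    (hx : iidLaw p x ≠ 0) (hs : ∑ t, infoDensity p Q (x t) (y t) ≤ s) :
    channelPow Q x y ≤ exp s * outputLaw (iidLaw p) (channelPow Q) y := by
  have hout := (outputLaw_mem_stdSimplex (iidLaw_mem_stdSimplex (n := k) hp)
    (channelPow_mem_stdSimplex hQ)).1 y
  by_cases hxy : channelPow Q x y = 0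
  · rw [hxy]; positivity
  · rw [channelPow_eq_exp_sum_infoDensity_mul hp hQ hx hxy]
    gcongr

theorem one_sub_one_div_exp_pow_le {s d : ℝ} (hs : 0 ≤ s) {L : ℕ} (hL : exp (s + d) ≤ L) :
    (1 - 1 / exp s) ^ L ≤ exp (-d) := by
  have hd : d ≤ L / exp s := by
    rw [le_div_iff₀ (exp_pos s)]
    calc d * exp s ≤ exp d * exp s := by gcongr; linarith [add_one_le_exp d]
      _ ≤ L := by rwa [← exp_add, add_comm]
  calc (1 - 1 / exp s) ^ L ≤ exp (-(1 / exp s)) ^ L :=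
        pow_le_pow_left₀ (sub_nonneg.2 ((div_le_one (exp_pos s)).2 (one_le_exp hs)))
          (one_sub_le_exp_neg _) L
    _ = exp (-(L / exp s)) := by rw [← exp_nat_mul]; ring_nf
    _ ≤ exp (-d) := exp_le_exp.2 (neg_le_neg hd)

open scoped Classical in
/-- The covering theorem behind lossy source coding, with `-F` as the distortion. -/
theorem eventually_exists_source_code (hp : p ∈ stdSimplex ℝ X) (hQ : ∀ x, Q x ∈ stdSimplex ℝ Y)
    (F : X → Y → ℝ) {R ε : ℝ} (hR : mutualInfoNat p Q < R) (hε : 0 < ε) :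
    ∀ᶠ n : ℕ in atTop, ∀ L : ℕ, exp (n * R) ≤ L → ∃ c : Fin L → Fin n → X,
      ∑ y : Fin n → Y with (∀ i, ∑ t, F (c i t) (y t) ≤
        n * (∑ x, p x * ∑ y, Q x y * F x y - ε)), iidLaw (outputLaw p Q) y ≤ ε := by
  set I := mutualInfoNat p Q with hI
  set EF := ∑ x, p x * ∑ y, Q x y * F x y
  obtain ⟨δ, hδ⟩ : ∃ δ, δ = (R - I) / 2 := ⟨_, rfl⟩
  have hδ0 : 0 < δ := by linarith
  have hI0 : 0 ≤ I := mutualInfoNat_nonneg hp hQ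
  have hε3 : 0 < ε / 3 := by linarith
  filter_upwards [eventually_exp_neg_mul_le hδ0 hε3,
    eventually_sum_sum_deviation_le hp hQ (infoDensity p Q) hδ0 hε3,
    eventually_sum_sum_deviation_le hp hQ F hε hε3] with n hexp hdensity hscore L hL
  rw [sum_mul_infoDensity hp hQ, ← hI] at hdensity
  let G (x : Fin n → X) (y : Fin n → Y) : Prop :=
    ∑ t, infoDensity p Q (x t) (y t) ≤ n * (I + δ) ∧ n * (EF - ε) < ∑ t, F (x t) (y t)
  obtain ⟨c, hc⟩ := exists_covering_words (G := G) (iidLaw_mem_stdSimplex hp)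
    (channelPow_mem_stdSimplex hQ) (one_le_exp (by positivity))
    (fun x y hx hG => channelPow_le_exp_mul_outputLaw hp hQ hx hG.1) L
  have hbad : ∑ x, ∑ y with ¬G x y, iidLaw p x * channelPow Q x y ≤ ε / 3 + ε / 3 := by
    refine (add_le_add hdensity hscore).trans' ?_
    rw [← sum_add_distrib]
    refine sum_le_sum fun x _ => (sum_filter_le_sum_filter_of_imp
      (iidLaw_mul_channelPow_nonneg hp hQ x) fun y _ hGxy => ?_).trans
      (sum_filter_or_le (iidLaw_mul_channelPow_nonneg hp hQ x) _ _)
    contrapose! hGxy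
    exact ⟨by linarith [(abs_lt.1 hGxy.1).2], by linarith [(abs_lt.1 hGxy.2).1]⟩
  have hpow : (1 - 1 / exp (n * (I + δ))) ^ L ≤ ε / 3 :=
    (one_sub_one_div_exp_pow_le (d := n * δ) (by positivity)
      (by convert hL using 2; rw [hδ]; ring)).trans hexp
  refine ⟨c, ?_⟩
  simp only [outputLaw_channelPow] at hc
  calc _ ≤ ∑ y with (∀ i, ¬G (c i) y), iidLaw (outputLaw p Q) y :=
        sum_filter_le_sum_filter_of_imp
          (iidLaw_mem_stdSimplex (outputLaw_mem_stdSimplex hp hQ)).1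
          fun y _ h i hG => (h i).not_gt hG.2
    _ ≤ ε := by linarith

end BlockCoding

section RobustPayoff

variable {Ω A : Type*} [Fintype Ω]

theorem optActions_nonempty [Finite A] [Nonempty A] (uR : Ω → A → ℝ) (ν : Ω → ℝ) :
    (optActions uR ν).Nonempty :=
  Finite.exists_max (expPayoff uR ν)

theorem robustPayoff_le_expPayoff [Finite A] (uS : Ω → A → ℝ) {uR : Ω → A → ℝ} {ν : Ω → ℝ} {a : A}
    (ha : a ∈ optActions uR ν) : robustPayoff uS uR ν ≤ expPayoff uS ν a :=
  csInf_le (Set.toFinite _).bddBelow ⟨a, ha, rfl⟩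

theorem exists_expPayoff_eq_robustPayoff [Finite A] [Nonempty A] (uS uR : Ω → A → ℝ)
    (ν : Ω → ℝ) : ∃ a ∈ optActions uR ν, expPayoff uS ν a = robustPayoff uS uR ν :=
  ((optActions_nonempty uR ν).image (expPayoff uS ν)).csInf_mem (Set.toFinite _)

theorem expPayoff_const_mul (u : Ω → A → ℝ) (c : ℝ) (ν : Ω → ℝ) (a : A) :
    expPayoff u (fun ω => c * ν ω) a = c * expPayoff u ν a := by
  simp [expPayoff, mul_sum, mul_assoc]

theorem optActions_const_mul (uR : Ω → A → ℝ) {c : ℝ} (hc : 0 < c) (ν : Ω → ℝ) :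
    optActions uR (fun ω => c * ν ω) = optActions uR ν := by
  ext a
  simp [optActions, expPayoff_const_mul, mul_le_mul_iff_right₀ hc]

theorem robustPayoff_const_mul [Finite A] [Nonempty A] (uS uR : Ω → A → ℝ) {c : ℝ} (hc : 0 ≤ c)
    (ν : Ω → ℝ) : robustPayoff uS uR (fun ω => c * ν ω) = c * robustPayoff uS uR ν := by
  rcases hc.eq_or_lt with rfl | hc
  · obtain ⟨a, -, ha⟩ := exists_expPayoff_eq_robustPayoff uS uR fun ω => 0 * ν ω
    rw [← ha, expPayoff_const_mul, zero_mul, zero_mul]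
  · simp only [robustPayoff, optActions_const_mul uR hc, expPayoff_const_mul]
    rw [← smul_eq_mul c, ← Real.sInf_smul_of_nonneg hc.le, ← Set.image_smul, Set.image_image]
    rfl

theorem exists_forall_abs_le {Ω A : Type*} [Finite Ω] [Finite A] (u : Ω → A → ℝ) :
    ∃ B : ℝ, ∀ ω a, |u ω a| ≤ B := by
  obtain ⟨B, hB⟩ := (Set.finite_range fun z : Ω × A => |u z.1 z.2|).bddAbove
  exact ⟨B, fun ω a => hB ⟨(ω, a), rfl⟩⟩

theorem abs_robustPayoff_le [Finite A] [Nonempty A] {uS : Ω → A → ℝ} (uR : Ω → A → ℝ) {B : ℝ}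
    (hB : ∀ ω a, |uS ω a| ≤ B) {q : Ω → ℝ} (hq : ∀ ω, 0 ≤ q ω) :
    |robustPayoff uS uR q| ≤ B * ∑ ω, q ω := by
  obtain ⟨a, -, ha⟩ := exists_expPayoff_eq_robustPayoff uS uR q
  rw [← ha, expPayoff, mul_sum]
  refine (abs_sum_le_sum_abs _ _).trans (sum_le_sum fun ω _ => ?_)
  rw [abs_mul, abs_of_nonneg (hq ω), mul_comm]
  exact mul_le_mul_of_nonneg_right (hB ω a) (hq ω)

theorem exists_forall_abs_robustPayoff_le [Finite A] [Nonempty A] (uS uR : Ω → A → ℝ) :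
    ∃ B : ℝ, ∀ q ∈ stdSimplex ℝ Ω, |robustPayoff uS uR q| ≤ B := by
  obtain ⟨B, hB⟩ := exists_forall_abs_le uS
  exact ⟨B, fun q hq => by simpa [hq.2] using abs_robustPayoff_le uR hB hq.1⟩

theorem continuous_expPayoff (u : Ω → A → ℝ) (a : A) : Continuous fun ν => expPayoff u ν a := by
  unfold expPayoff
  fun_prop

theorem eventually_mem_optActions_of_mem_optActions (uR : Ω → A → ℝ) (ν : Ω → ℝ) (a : A) :
    ∀ᶠ q in 𝓝 ν, a ∈ optActions uR q → a ∈ optActions uR ν := by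
  by_cases ha : a ∈ optActions uR ν
  · exact Eventually.of_forall fun _ _ => ha
  · obtain ⟨b, hb⟩ : ∃ b, expPayoff uR ν a < expPayoff uR ν b := by simpa [optActions] using ha
    filter_upwards [(continuous_expPayoff uR a).continuousAt.eventually_lt
      (continuous_expPayoff uR b).continuousAt hb] with q hq ha'
    exact absurd (ha' b) hq.not_ge

theorem lowerSemicontinuous_robustPayoff [Finite A] [Nonempty A] (uS uR : Ω → A → ℝ) :
    LowerSemicontinuous (robustPayoff uS uR) := by
  intro ν v hv
  have hpayoff (a : A) :
      ∀ᶠ q in 𝓝 ν, robustPayoff uS uR ν ≤ expPayoff uS ν a → v < expPayoff uS q a := by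
    by_cases ha : robustPayoff uS uR ν ≤ expPayoff uS ν a
    · filter_upwards [(continuous_expPayoff uS a).continuousAt.eventually_const_lt
        (hv.trans_le ha)] with q hq _ using hq
    · exact Eventually.of_forall fun _ h => absurd h ha
  filter_upwards [eventually_all.2 (eventually_mem_optActions_of_mem_optActions uR ν),
    eventually_all.2 hpayoff] with q hopt hpayoff
  obtain ⟨a, ha, hval⟩ := exists_expPayoff_eq_robustPayoff uS uR q
  rw [← hval]
  exact hpayoff a (robustPayoff_le_expPayoff uS (hopt a ha))

end RobustPayoff

section DivergenceBound

variable {Ω : Type*} [Fintype Ω]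

/-- The beliefs whose support is contained in the support of `μ`. -/
def supportedBeliefs (μ : Ω → ℝ) : Set (Ω → ℝ) :=
  {ν | ν ∈ stdSimplex ℝ Ω ∧ ∀ ω, μ ω = 0 → ν ω = 0}

/-- By Pinsker's inequality a belief that is not close to `ν` has a divergence from `ν` that is
bounded below, so a large enough multiple of it exceeds the oscillation of `f`. -/
theorem exists_sub_mul_divergence_le {f : (Ω → ℝ) → ℝ} {B ε : ℝ}
    (hB : ∀ q ∈ stdSimplex ℝ Ω, |f q| ≤ B) {ν : Ω → ℝ} (hν : ν ∈ stdSimplex ℝ Ω) (hε : 0 < ε)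
    (hf : LowerSemicontinuousWithinAt f (supportedBeliefs ν) ν) :
    ∃ K : ℝ, 0 ≤ K ∧ ∀ q ∈ supportedBeliefs ν, f ν - ε - K * divergence q ν ≤ f q := by
  obtain ⟨η, hη, hball⟩ := Metric.mem_nhdsWithin_iff.1 (hf (f ν - ε) (sub_lt_self _ hε))
  have hB0 : 0 ≤ B := (abs_nonneg _).trans (hB ν hν)
  refine ⟨8 * B / η ^ 2, by positivity, fun q hq => ?_⟩
  have hdiv : 0 ≤ divergence q ν := divergence_nonneg hq.1.1 hν.1 hq.2 hν.2.le
  rcases lt_or_ge (4 * divergence q ν) (η ^ 2) with hnear | hfar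
  · have hqball : q ∈ Metric.ball ν η := by
      rw [Metric.mem_ball, dist_pi_lt_iff hη]
      intro ω
      rw [dist_eq]
      exact abs_lt_of_sq_lt_sq
        ((sq_sub_le_four_mul_divergence hq.1 hν hq.2 ω).trans_lt hnear) hη.le
    have hclose : f ν - ε < f q := hball ⟨hqball, hq⟩
    have hpenalty : 0 ≤ 8 * B / η ^ 2 * divergence q ν := by positivity
    linarith
  · have hpenalty : 2 * B ≤ 8 * B / η ^ 2 * divergence q ν := by
      rw [div_mul_eq_mul_div, le_div_iff₀ (by positivity)]
      nlinarith
    linarith [(abs_le.1 (hB ν hν)).2, (abs_le.1 (hB q hq.1)).1]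

end DivergenceBound

section Game

variable {Ω A X Y : Type*} [Fintype Ω] [Fintype X] {uS uR : Ω → A → ℝ} {μ : Ω → ℝ}
  {Q : X → Y → ℝ} {n k : ℕ} {σ : (Fin n → Ω) → (Fin k → X) → ℝ}

/-- The joint law of the output `y` and the states `ω`. Its section at `y` is the receiver's
unnormalized belief after `y`. -/
def jointLaw {Ω : Type*} (μ : Ω → ℝ) (Q : X → Y → ℝ) {n k : ℕ} (σ : (Fin n → Ω) → (Fin k → X) → ℝ)
    (y : Fin k → Y) (ω : Fin n → Ω) : ℝ :=
  ∑ x, iidLaw μ ω * σ ω x * channelPow Q x y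

/-- The sender's payoff from `σ` at the worst best reply. Best replies act separately on each
problem, so this is a sum of robust payoffs at the unnormalized marginal beliefs. -/
def robustValue [Fintype Y] (uS uR : Ω → A → ℝ) (μ : Ω → ℝ) (Q : X → Y → ℝ) {n k : ℕ}
    (σ : (Fin n → Ω) → (Fin k → X) → ℝ) : ℝ :=
  1 / n * ∑ y, ∑ t, robustPayoff uS uR (marginal (jointLaw μ Q σ y) t)

theorem sum_sum_mul_avgPayoff (u : Ω → A → ℝ) (y : Fin k → Y) (a : Fin n → A) :
    ∑ ω, ∑ x, iidLaw μ ω * σ ω x * channelPow Q x y * avgPayoff u ω a =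
      1 / n * ∑ t, expPayoff u (marginal (jointLaw μ Q σ y) t) (a t) := by
  simp only [expPayoff, sum_marginal_mul _ _ (fun ω => u ω _), ← sum_mul]
  rw [sum_comm, mul_sum]
  refine sum_congr rfl fun ω _ => ?_
  rw [← mul_sum, avgPayoff, jointLaw]
  ring

theorem mem_bestReplies_iff (hn : 0 < n) {τ : (Fin k → Y) → (Fin n → A)} :
    τ ∈ bestReplies uR μ Q σ ↔ ∀ y t, τ y t ∈ optActions uR (marginal (jointLaw μ Q σ y) t) := by
  classical
  have hn : (0 : ℝ) < 1 / n := by positivity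
  simp only [bestReplies, Set.mem_ofPred_eq, sum_sum_mul_avgPayoff, mul_le_mul_iff_right₀ hn]
  refine forall_congr' fun y => ⟨fun h t b => ?_, fun h a => sum_le_sum fun t _ => h t (a t)⟩
  have hdeviation := h (Function.update (τ y) t b)
  rw [← add_sum_erase _ _ (mem_univ t), ← add_sum_erase _ _ (mem_univ t)] at hdeviation
  have hother (s : Fin n) (hs : s ∈ univ.erase t) :
      expPayoff uR (marginal (jointLaw μ Q σ y) s) (Function.update (τ y) t b s) =
        expPayoff uR (marginal (jointLaw μ Q σ y) s) (τ y s) := by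
    rw [Function.update_of_ne (ne_of_mem_erase hs)]
  rw [sum_congr rfl hother, Function.update_self] at hdeviation
  linarith

variable [Fintype Y]

theorem senderPayoff_eq (τ : (Fin k → Y) → (Fin n → A)) :
    senderPayoff uS μ Q σ τ =
      1 / n * ∑ y, ∑ t, expPayoff uS (marginal (jointLaw μ Q σ y) t) (τ y t) := by
  rw [mul_sum]
  simp only [← sum_sum_mul_avgPayoff, senderPayoff]
  symm
  rw [sum_comm]
  exact sum_congr rfl fun ω _ => sum_comm

theorem sInf_senderPayoff_eq_robustValue [Finite A] [Nonempty A] (hn : 0 < n) :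
    sInf (senderPayoff uS μ Q σ '' bestReplies uR μ Q σ) = robustValue uS uR μ Q σ := by
  refine IsLeast.csInf_eq ⟨?_, ?_⟩
  · choose τ hτ hval using fun y t =>
      exists_expPayoff_eq_robustPayoff uS uR (marginal (jointLaw μ Q σ y) t)
    exact ⟨τ, (mem_bestReplies_iff hn).2 hτ, by simp only [senderPayoff_eq, robustValue, hval]⟩
  · rintro _ ⟨τ, hτ, rfl⟩
    rw [senderPayoff_eq, robustValue]
    gcongr with y _ t _
    exact robustPayoff_le_expPayoff uS ((mem_bestReplies_iff hn).1 hτ y t)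

theorem jointLaw_nonneg (hμ : μ ∈ stdSimplex ℝ Ω) (hQ : ∀ x, Q x ∈ stdSimplex ℝ Y)
    (hσ : σ ∈ senderStrategies Ω X n k) (y : Fin k → Y) (ω : Fin n → Ω) :
    0 ≤ jointLaw μ Q σ y ω :=
  sum_nonneg fun x _ => mul_nonneg (mul_nonneg ((iidLaw_mem_stdSimplex hμ).1 ω) ((hσ ω).1 x))
    ((channelPow_mem_stdSimplex hQ x).1 y)

theorem sum_jointLaw {Ω : Type*} {μ : Ω → ℝ} {σ : (Fin n → Ω) → (Fin k → X) → ℝ}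
    (hQ : ∀ x, Q x ∈ stdSimplex ℝ Y) (hσ : σ ∈ senderStrategies Ω X n k) (ω : Fin n → Ω) :
    ∑ y, jointLaw μ Q σ y ω = iidLaw μ ω := by
  simp only [jointLaw]
  rw [sum_comm]
  simp [← mul_sum, (channelPow_mem_stdSimplex hQ _).2, (hσ ω).2]

theorem sum_marginal_jointLaw (hμ : μ ∈ stdSimplex ℝ Ω) (hQ : ∀ x, Q x ∈ stdSimplex ℝ Y)
    (hσ : σ ∈ senderStrategies Ω X n k) (t : Fin n) (ω : Ω) :
    ∑ y, marginal (jointLaw μ Q σ y) t ω = μ ω := by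
  classical
  refine Eq.trans ?_ (congrFun (marginal_iidLaw hμ t) ω)
  simp only [marginal]
  rw [sum_comm]
  refine sum_congr rfl fun x _ => ?_
  split_ifs
  · exact sum_jointLaw hQ hσ x
  · simp

theorem sum_sum_jointLaw (hμ : μ ∈ stdSimplex ℝ Ω) (hQ : ∀ x, Q x ∈ stdSimplex ℝ Y)
    (hσ : σ ∈ senderStrategies Ω X n k) : ∑ y, ∑ ω, jointLaw μ Q σ y ω = 1 := by
  rw [sum_comm]
  simp only [sum_jointLaw hQ hσ]
  exact (iidLaw_mem_stdSimplex hμ).2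

theorem abs_robustValue_le [Finite A] [Nonempty A] (hn : 0 < n) (hμ : μ ∈ stdSimplex ℝ Ω)
    (hQ : ∀ x, Q x ∈ stdSimplex ℝ Y) {B : ℝ} (hB : ∀ ω a, |uS ω a| ≤ B)
    (hσ : σ ∈ senderStrategies Ω X n k) : |robustValue uS uR μ Q σ| ≤ B := by
  have hn : (0 : ℝ) < n := by exact_mod_cast hn
  rw [robustValue, abs_mul, abs_of_pos (by positivity), one_div_mul_eq_div, div_le_iff₀ hn]
  calc |∑ y, ∑ t, robustPayoff uS uR (marginal (jointLaw μ Q σ y) t)|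
      ≤ ∑ y, ∑ _t : Fin n, B * ∑ ω, jointLaw μ Q σ y ω := by
        refine (abs_sum_le_sum_abs _ _).trans (sum_le_sum fun y _ => ?_)
        refine (abs_sum_le_sum_abs _ _).trans (sum_le_sum fun t _ => ?_)
        rw [← sum_marginal _ t]
        exact abs_robustPayoff_le _ hB (marginal_nonneg (jointLaw_nonneg hμ hQ hσ y) t)
    _ = B * n := by
        simp only [sum_const, card_univ, Fintype.card_fin, nsmul_eq_mul, ← mul_sum,
          sum_sum_jointLaw hμ hQ hσ]
        ring

theorem optimalRobustPayoff_eq_sSup_robustValue [Finite A] [Nonempty A] (hn : 0 < n) :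
    optimalRobustPayoff uS uR μ Q n k =
      sSup (robustValue uS uR μ Q '' senderStrategies Ω X n k) := by
  simp only [optimalRobustPayoff, sInf_senderPayoff_eq_robustValue hn]

theorem robustValue_le_optimalRobustPayoff [Finite A] [Nonempty A] (hn : 0 < n)
    (hμ : μ ∈ stdSimplex ℝ Ω) (hQ : ∀ x, Q x ∈ stdSimplex ℝ Y)
    (hσ : σ ∈ senderStrategies Ω X n k) :
    robustValue uS uR μ Q σ ≤ optimalRobustPayoff uS uR μ Q n k := by
  rw [optimalRobustPayoff_eq_sSup_robustValue hn]
  obtain ⟨B, hB⟩ := exists_forall_abs_le uS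
  refine le_csSup ⟨B, ?_⟩ ⟨σ, hσ, rfl⟩
  rintro _ ⟨σ', hσ', rfl⟩
  exact (abs_le.1 (abs_robustValue_le hn hμ hQ hB hσ')).2

end Game

section Capacity

variable {X Y : Type*} [Fintype X] [Fintype Y] {p : X → ℝ} {Q : X → Y → ℝ}

theorem mutualInfo_eq_mutualInfoNat_div_log (hp : p ∈ stdSimplex ℝ X)
    (hQ : ∀ x, Q x ∈ stdSimplex ℝ Y) : mutualInfo p Q = mutualInfoNat p Q / log 2 := by
  have hout := entropy_eq_massEntropy_div_log (outputLaw_mem_stdSimplex hp hQ).2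
  simp only [mutualInfo, mutualInfoNat, entropy_eq_massEntropy_div_log (hQ _).2, sub_div, sum_div,
    ← mul_div_assoc]
  rw [← hout]
  rfl

theorem bddAbove_mutualInfo (hQ : ∀ x, Q x ∈ stdSimplex ℝ Y) :
    BddAbove ((fun p => mutualInfo p Q) '' stdSimplex ℝ X) := by
  refine ⟨log (Fintype.card Y) / log 2, ?_⟩
  rintro _ ⟨p, hp, rfl⟩
  simp only [mutualInfo_eq_mutualInfoNat_div_log hp hQ]
  gcongr
  have hnoise : 0 ≤ ∑ x, p x * massEntropy (Q x) :=
    sum_nonneg fun x _ => mul_nonneg (hp.1 x) (massEntropy_nonneg (hQ x).1)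
  exact (sub_le_self _ hnoise).trans (massEntropy_le_log_card (outputLaw_mem_stdSimplex hp hQ))

theorem mutualInfoNat_le_capacity_mul_log (hp : p ∈ stdSimplex ℝ X)
    (hQ : ∀ x, Q x ∈ stdSimplex ℝ Y) : mutualInfoNat p Q ≤ capacity Q * log 2 := by
  rw [← div_le_iff₀ (log_pos one_lt_two), ← mutualInfo_eq_mutualInfoNat_div_log hp hQ]
  exact le_csSup (bddAbove_mutualInfo hQ) ⟨p, hp, rfl⟩

theorem nonempty_stdSimplex [Nonempty X] : (stdSimplex ℝ X).Nonempty := by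
  classical
  exact ⟨_, single_mem_stdSimplex ℝ (Classical.arbitrary X)⟩

theorem capacity_nonneg [Nonempty X] (hQ : ∀ x, Q x ∈ stdSimplex ℝ Y) : 0 ≤ capacity Q := by
  obtain ⟨p, hp⟩ := nonempty_stdSimplex (X := X)
  exact nonneg_of_mul_nonneg_left
    ((mutualInfoNat_nonneg hp hQ).trans (mutualInfoNat_le_capacity_mul_log hp hQ))
    (log_pos one_lt_two)

theorem exists_lt_mutualInfoNat [Nonempty X] (hQ : ∀ x, Q x ∈ stdSimplex ℝ Y) {c : ℝ}
    (hc : c < capacity Q * log 2) : ∃ p ∈ stdSimplex ℝ X, c < mutualInfoNat p Q := by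
  have hlog := log_pos one_lt_two
  rw [← div_lt_iff₀ hlog] at hc
  obtain ⟨_, ⟨p, hp, rfl⟩, hlt⟩ := exists_lt_of_lt_csSup (nonempty_stdSimplex.image _) hc
  simp only [mutualInfo_eq_mutualInfoNat_div_log hp hQ] at hlt
  exact ⟨p, hp, (div_lt_div_iff_of_pos_right hlog).1 hlt⟩

theorem marginal_outputLaw_channelPow (hQ : ∀ x, Q x ∈ stdSimplex ℝ Y) {k : ℕ}
    (p : (Fin k → X) → ℝ) (t : Fin k) :
    marginal (outputLaw p (channelPow Q)) t = outputLaw (marginal p t) Q := by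
  classical
  funext y
  have hchannel (x : Fin k → X) : marginal (channelPow Q x) t = Q (x t) :=
    marginal_prod (p := fun t => Q (x t)) (fun t => hQ (x t)) t
  rw [outputLaw, sum_marginal_mul p t (fun x => Q x y)]
  simp only [← hchannel, marginal, outputLaw, ← sum_filter, mul_sum]
  rw [sum_comm]

theorem sum_mul_massEntropy_channelPow (hQ : ∀ x, Q x ∈ stdSimplex ℝ Y) {k : ℕ}
    (p : (Fin k → X) → ℝ) :
    ∑ x, p x * massEntropy (channelPow Q x) = ∑ t, ∑ x, marginal p t x * massEntropy (Q x) := by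
  simp only [sum_marginal_mul p _ (fun x => massEntropy (Q x))]
  rw [sum_comm]
  refine sum_congr rfl fun x _ => ?_
  rw [← mul_sum]
  exact congrArg _ (massEntropy_prod (p := fun t => Q (x t)) fun t => hQ (x t))

theorem mutualInfoNat_channelPow_le (hQ : ∀ x, Q x ∈ stdSimplex ℝ Y) {k : ℕ}
    {p : (Fin k → X) → ℝ} (hp : p ∈ stdSimplex ℝ (Fin k → X)) :
    mutualInfoNat p (channelPow Q) ≤ k * (capacity Q * log 2) := by
  have hmarginal (t : Fin k) : marginal p t ∈ stdSimplex ℝ X :=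
    ⟨marginal_nonneg hp.1 t, by rw [sum_marginal, hp.2]⟩
  have hsubadd := massEntropy_le_sum_massEntropy_marginal
    (outputLaw_mem_stdSimplex hp (channelPow_mem_stdSimplex hQ)).1
  calc mutualInfoNat p (channelPow Q) ≤ ∑ t, mutualInfoNat (marginal p t) Q := by
        simp only [mutualInfoNat, sum_mul_massEntropy_channelPow hQ, sum_sub_distrib,
          ← marginal_outputLaw_channelPow hQ]
        linarith
    _ ≤ ∑ _t : Fin k, capacity Q * log 2 :=
        sum_le_sum fun t _ => mutualInfoNat_le_capacity_mul_log (hmarginal t) hQ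
    _ = _ := by simp

theorem mutualInfoNat_eq_sum_mul_divergence (hp : p ∈ stdSimplex ℝ X)
    (hQ : ∀ x, Q x ∈ stdSimplex ℝ Y) :
    mutualInfoNat p Q = ∑ x, p x * divergence (Q x) (outputLaw p Q) := by
  have hcross : massEntropy (outputLaw p Q) = ∑ x, p x * crossEntropy (Q x) (outputLaw p Q) := by
    simp only [massEntropy, (outputLaw_mem_stdSimplex hp hQ).2, log_one, zero_sub, mul_neg,
      sum_neg_distrib, crossEntropy, mul_sum]
    rw [sum_comm]
    simp only [← mul_assoc, ← sum_mul, outputLaw]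
  simp only [mutualInfoNat, hcross, divergence, mul_sub, sum_sub_distrib]

end Capacity

section Splitting

variable {Ω A : Type*} [Fintype Ω] {uS uR : Ω → A → ℝ} {μ : Ω → ℝ} {M : ℕ} {lam : Fin M → ℝ}
  {ν : Fin M → Ω → ℝ}

theorem IsSplitting.outputLaw_eq (h : IsSplitting μ lam ν) : outputLaw lam ν = μ :=
  funext h.average

theorem IsSplitting.mem_stdSimplex (h : IsSplitting μ lam ν) : μ ∈ stdSimplex ℝ Ω :=
  h.outputLaw_eq ▸ outputLaw_mem_stdSimplex h.weights h.posteriors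

theorem IsSplitting.splittingInfo_eq (h : IsSplitting μ lam ν) :
    splittingInfo μ lam ν = mutualInfoNat lam ν / log 2 := by
  rw [← mutualInfo_eq_mutualInfoNat_div_log h.weights h.posteriors, splittingInfo, mutualInfo]
  simp only [h.average]

theorem IsSplitting.mutualInfoNat_eq_sum_mul_divergence (h : IsSplitting μ lam ν) :
    mutualInfoNat lam ν = ∑ m, lam m * divergence (ν m) μ := by
  rw [Persuasion.mutualInfoNat_eq_sum_mul_divergence h.weights h.posteriors, h.outputLaw_eq]

theorem IsSplitting.posterior_mem_supportedBeliefs (h : IsSplitting μ lam ν) {m : Fin M}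
    (hm : 0 < lam m) : ν m ∈ supportedBeliefs μ := by
  refine ⟨h.posteriors m, fun ω hω => ?_⟩
  rw [← h.average, sum_eq_zero_iff_of_nonneg fun m _ =>
    mul_nonneg (h.weights.1 m) ((h.posteriors m).1 ω)] at hω
  exact (mul_eq_zero.1 (hω m (mem_univ m))).resolve_left hm.ne'

theorem eq_of_divergence_eq_zero {q : Ω → ℝ} (hμ : μ ∈ stdSimplex ℝ Ω)
    (hq : q ∈ supportedBeliefs μ) (h : divergence q μ = 0) : q = μ := by
  funext ω
  have hpinsker := sq_sub_le_four_mul_divergence hq.1 hμ hq.2 ω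
  rw [h, mul_zero] at hpinsker
  exact sub_eq_zero.1 (sq_eq_zero_iff.1 (hpinsker.antisymm (sq_nonneg _)))

theorem exists_mem_stdSimplex_sum_mul_eq (hμ : μ ∈ stdSimplex ℝ Ω) {q : Ω → ℝ}
    (hq : ∀ ω, 0 ≤ q ω) : ∃ ν ∈ stdSimplex ℝ Ω, q = fun ω => (∑ ω, q ω) * ν ω := by
  by_cases hZ : ∑ ω, q ω = 0
  · refine ⟨μ, hμ, funext fun ω => ?_⟩
    rw [hZ, zero_mul]
    exact (sum_eq_zero_iff_of_nonneg fun ω _ => hq ω).1 hZ ω (mem_univ ω)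
  · refine ⟨fun ω => q ω / ∑ ω, q ω, ⟨fun ω => div_nonneg (hq ω) (sum_nonneg fun ω _ => hq ω), ?_⟩,
      funext fun ω => (mul_div_cancel₀ _ hZ).symm⟩
    rw [← sum_div, div_self hZ]

theorem bddAbove_splittingPayoffs [Finite A] [Nonempty A] (uS uR : Ω → A → ℝ) (μ : Ω → ℝ)
    (c : EReal) :
    BddAbove {v | ∃ (M : ℕ) (lam : Fin M → ℝ) (ν : Fin M → Ω → ℝ),
      IsSplitting μ lam ν ∧ ((splittingInfo μ lam ν : ℝ) : EReal) ≤ c ∧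
      v = ∑ m, lam m * robustPayoff uS uR (ν m)} := by
  obtain ⟨B, hB⟩ := exists_forall_abs_robustPayoff_le uS uR
  refine ⟨B, ?_⟩
  rintro _ ⟨M, lam, ν, h, -, rfl⟩
  calc ∑ m, lam m * robustPayoff uS uR (ν m) ≤ ∑ m, lam m * B :=
        sum_le_sum fun m _ => mul_le_mul_of_nonneg_left
          (abs_le.1 (hB _ (h.posteriors m))).2 (h.weights.1 m)
    _ = B := by rw [← sum_mul, h.weights.2, one_mul]

/-- A splitting is described by the joint law `J` of the message and the state: the weights and the
posteriors are recovered by normalization. -/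
theorem sum_robustPayoff_le_splittingValue [Finite A] [Nonempty A] {ι : Type*} [Fintype ι]
    (hμ : μ ∈ stdSimplex ℝ Ω) {J : ι → Ω → ℝ} (hJ : ∀ i ω, 0 ≤ J i ω)
    (hJμ : ∀ ω, ∑ i, J i ω = μ ω) {c : EReal}
    (hc : (((massEntropy μ - ∑ i, massEntropy (J i)) / log 2 : ℝ) : EReal) ≤ c) :
    ∑ i, robustPayoff uS uR (J i) ≤ splittingValue uS uR μ c := by
  choose ν hν hJν using fun i => exists_mem_stdSimplex_sum_mul_eq hμ (hJ i)
  have hJ0 (i : ι) : 0 ≤ ∑ ω, J i ω := sum_nonneg fun ω _ => hJ i ω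
  let e := (Fintype.equivFin ι).symm
  have hsplit : IsSplitting μ (fun m => ∑ ω, J (e m) ω) (fun m => ν (e m)) := by
    refine ⟨⟨fun m => hJ0 _, ?_⟩, fun m => hν _, fun ω => ?_⟩
    · rw [e.sum_comp fun i => ∑ ω, J i ω, sum_comm]
      simp only [hJμ, hμ.2]
    · rw [e.sum_comp fun i => (∑ ω, J i ω) * ν i ω, ← hJμ ω]
      exact sum_congr rfl fun i _ => (congrFun (hJν i) ω).symm
  refine le_csSup (bddAbove_splittingPayoffs uS uR μ c) ⟨_, _, _, hsplit, ?_, ?_⟩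
  · have hentropy : ∑ i, (∑ ω, J i ω) * massEntropy (ν i) = ∑ i, massEntropy (J i) :=
      sum_congr rfl fun i _ => by rw [← massEntropy_const_mul (hν i).1, ← hJν]
    rwa [hsplit.splittingInfo_eq, mutualInfoNat, hsplit.outputLaw_eq,
      e.sum_comp fun i => (∑ ω, J i ω) * massEntropy (ν i), hentropy]
  · rw [e.sum_comp fun i => (∑ ω, J i ω) * robustPayoff uS uR (ν i)]
    exact sum_congr rfl fun i _ => by rw [← robustPayoff_const_mul uS uR (hJ0 i), ← hJν]

theorem splittingValue_le (hμ : μ ∈ stdSimplex ℝ Ω) {c : EReal} (hc : 0 ≤ c) {v : ℝ}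
    (h : ∀ (M : ℕ) (lam : Fin M → ℝ) (ν : Fin M → Ω → ℝ), IsSplitting μ lam ν →
      ((mutualInfoNat lam ν / log 2 : ℝ) : EReal) ≤ c →
        ∑ m, lam m * robustPayoff uS uR (ν m) ≤ v) :
    splittingValue uS uR μ c ≤ v := by
  refine csSup_le ⟨_, 1, fun _ => 1, fun _ => μ, ⟨⟨by simp, by simp⟩, fun _ => hμ, by simp⟩,
    by simpa [splittingInfo] using hc, rfl⟩ ?_
  rintro _ ⟨M, lam, ν, hsplit, hinfo, rfl⟩
  exact h M lam ν hsplit (hsplit.splittingInfo_eq ▸ hinfo)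

theorem splittingValue_mono [Finite A] [Nonempty A] (hμ : μ ∈ stdSimplex ℝ Ω) {c c' : EReal}
    (hc : 0 ≤ c) (h : c ≤ c') : splittingValue uS uR μ c ≤ splittingValue uS uR μ c' :=
  splittingValue_le hμ hc fun _ _ _ hsplit hinfo =>
    le_csSup (bddAbove_splittingPayoffs uS uR μ c')
      ⟨_, _, _, hsplit, hsplit.splittingInfo_eq ▸ hinfo.trans h, rfl⟩

theorem splittingValue_zero [Finite A] [Nonempty A] (hμ : μ ∈ stdSimplex ℝ Ω) :
    splittingValue uS uR μ 0 = robustPayoff uS uR μ := by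
  refine le_antisymm (splittingValue_le hμ le_rfl fun M lam ν hsplit hinfo => ?_) ?_
  · have hinfo : mutualInfoNat lam ν / log 2 ≤ 0 := by exact_mod_cast hinfo
    rw [div_le_iff₀ (log_pos one_lt_two), zero_mul,
      hsplit.mutualInfoNat_eq_sum_mul_divergence] at hinfo
    have hdiv (m : Fin M) : 0 ≤ lam m * divergence (ν m) μ := by
      rcases (hsplit.weights.1 m).eq_or_lt with hm | hm
      · simp [← hm]
      · have hν := hsplit.posterior_mem_supportedBeliefs hm
        exact mul_nonneg hm.le (divergence_nonneg hν.1.1 hμ.1 hν.2 hμ.2.le)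
    have hzero := (sum_eq_zero_iff_of_nonneg fun m _ => hdiv m).1
      (hinfo.antisymm (sum_nonneg fun m _ => hdiv m))
    have htrivial (m : Fin M) :
        lam m * robustPayoff uS uR (ν m) = lam m * robustPayoff uS uR μ := by
      rcases (hsplit.weights.1 m).eq_or_lt with hm | hm
      · simp [← hm]
      · rw [eq_of_divergence_eq_zero hμ (hsplit.posterior_mem_supportedBeliefs hm)
          ((mul_eq_zero.1 (hzero m (mem_univ m))).resolve_left hm.ne')]
    simp only [htrivial, ← sum_mul, hsplit.weights.2, one_mul, le_refl]
  · simpa using sum_robustPayoff_le_splittingValue (uS := uS) (uR := uR) (J := fun _ : Unit => μ)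
      (c := 0) hμ (fun _ => hμ.1) (by simp) (by simp)

/-- Mixing a splitting with the trivial one scales the transmitted information. -/
theorem mix_robustPayoff_splittingValue_le [Finite A] [Nonempty A] (hμ : μ ∈ stdSimplex ℝ Ω)
    {c θ : ℝ} (hc : 0 ≤ c) (hθ0 : 0 < θ) (hθ1 : θ ≤ 1) :
    (1 - θ) * robustPayoff uS uR μ + θ * splittingValue uS uR μ (c : EReal) ≤
      splittingValue uS uR μ ((θ * c : ℝ) : EReal) := by
  rw [← le_sub_iff_add_le', ← le_div_iff₀' hθ0]
  refine splittingValue_le hμ (by exact_mod_cast hc) fun M lam ν hsplit hinfo => ?_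
  have hinfo : mutualInfoNat lam ν / log 2 ≤ c := by exact_mod_cast hinfo
  rw [le_div_iff₀' hθ0, le_sub_iff_add_le']
  have hweight (m : Fin M) : 0 ≤ θ * lam m := mul_nonneg hθ0.le (hsplit.weights.1 m)
  have hmixed := sum_robustPayoff_le_splittingValue (uS := uS) (uR := uR) (ι := Option (Fin M))
    (J := fun o ω => o.elim ((1 - θ) * μ ω) fun m => θ * lam m * ν m ω)
    (c := ((θ * c : ℝ) : EReal)) hμ ?_ ?_ ?_
  · simp only [Fintype.sum_option, Option.elim, robustPayoff_const_mul uS uR (hweight _),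
      robustPayoff_const_mul uS uR (sub_nonneg.2 hθ1)] at hmixed
    simpa only [mul_assoc, ← mul_sum] using hmixed
  · rintro (_ | m) ω
    · exact mul_nonneg (sub_nonneg.2 hθ1) (hμ.1 ω)
    · exact mul_nonneg (hweight m) ((hsplit.posteriors m).1 ω)
  · intro ω
    simp only [Fintype.sum_option, Option.elim, mul_assoc, ← mul_sum, hsplit.average]
    ring
  · rw [EReal.coe_le_coe_iff]
    simp only [Fintype.sum_option, Option.elim, massEntropy_const_mul hμ.1,
      massEntropy_const_mul (hsplit.posteriors _).1]
    simp only [mul_assoc, ← mul_sum]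
    refine (mul_le_mul_of_nonneg_left hinfo hθ0.le).trans' (le_of_eq ?_)
    rw [mutualInfoNat, hsplit.outputLaw_eq]
    ring

theorem upperSemicontinuousAt_splittingValue [Finite A] [Nonempty A] (hμ : μ ∈ stdSimplex ℝ Ω)
    {c : ℝ} (hc : 0 < c) :
    UpperSemicontinuousAt (fun c : ℝ => splittingValue uS uR μ (c : EReal)) c := by
  intro v hv
  set V := splittingValue uS uR μ (c : EReal)
  have hlim : Tendsto (fun θ : ℝ => (1 - θ) * robustPayoff uS uR μ + θ * v) (𝓝[<] 1) (𝓝 v) := by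
    have hcont : Continuous fun θ : ℝ => (1 - θ) * robustPayoff uS uR μ + θ * v := by fun_prop
    simpa using (hcont.tendsto 1).mono_left nhdsWithin_le_nhds
  have hbelow : ∀ᶠ θ in 𝓝[<] (1 : ℝ), θ < 1 := self_mem_nhdsWithin
  obtain ⟨θ, hθ, hθ1, hθ0⟩ := ((hlim.eventually_const_lt hv).and
    (hbelow.and (nhdsWithin_le_nhds (eventually_gt_nhds one_pos)))).exists
  have hc' : c < c / θ := (lt_div_iff₀ hθ0).2 (mul_lt_of_lt_one_right hc hθ1)
  filter_upwards [eventually_lt_nhds hc', eventually_gt_nhds hc] with c₁ hc₁ hc₁0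
  have hmix := mix_robustPayoff_splittingValue_le (uS := uS) (uR := uR) hμ hc₁0.le hθ0 hθ1.le
  have hmono : splittingValue uS uR μ ((θ * c₁ : ℝ) : EReal) ≤ V :=
    splittingValue_mono hμ (by exact_mod_cast (by positivity))
      (by exact_mod_cast ((lt_div_iff₀' hθ0).1 hc₁).le)
  exact lt_of_mul_lt_mul_left (by linarith) hθ0.le

end Splitting

section Converse

variable {Ω A X Y : Type*} [Fintype Ω] [Fintype X] [Fintype Y] {uS uR : Ω → A → ℝ} {μ : Ω → ℝ}
  {Q : X → Y → ℝ} {n k : ℕ} {σ : (Fin n → Ω) → (Fin k → X) → ℝ}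

/-- Data processing: the outputs depend on the states only through the inputs. -/
theorem massEntropy_iidLaw_sub_sum_massEntropy_jointLaw_le (hμ : μ ∈ stdSimplex ℝ Ω)
    (hQ : ∀ x, Q x ∈ stdSimplex ℝ Y) (hσ : σ ∈ senderStrategies Ω X n k) :
    n * massEntropy μ - ∑ y, massEntropy (jointLaw μ Q σ y) ≤
      mutualInfoNat (outputLaw (iidLaw μ) σ) (channelPow Q) := by
  have hchain := massEntropy_add_sum_massEntropy_comm
    fun (ω : Fin n → Ω) (y : Fin k → Y) => jointLaw μ Q σ y ω
  have hstates : massEntropy (fun ω => ∑ y, jointLaw μ Q σ y ω) = n * massEntropy μ := by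
    simp only [sum_jointLaw hQ hσ]
    exact massEntropy_iidLaw hμ
  have houtputs : (fun y => ∑ ω, jointLaw μ Q σ y ω) =
      outputLaw (outputLaw (iidLaw μ) σ) (channelPow Q) := by
    funext y
    simp only [jointLaw, outputLaw, sum_mul]
    rw [sum_comm]
  have hnoise : ∑ x, outputLaw (iidLaw μ) σ x * massEntropy (channelPow Q x) ≤
      ∑ ω, massEntropy (fun y => jointLaw μ Q σ y ω) := by
    simp only [outputLaw, sum_mul]
    rw [sum_comm]
    refine sum_le_sum fun ω _ => ?_
    have hconcave := sum_massEntropy_le_massEntropy_sum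
      (q := fun x y => iidLaw μ ω * σ ω x * channelPow Q x y) fun x y =>
        mul_nonneg (mul_nonneg ((iidLaw_mem_stdSimplex hμ).1 ω) ((hσ ω).1 x))
          ((channelPow_mem_stdSimplex hQ x).1 y)
    simp only [massEntropy_const_mul (channelPow_mem_stdSimplex hQ _).1] at hconcave
    exact hconcave
  rw [hstates, houtputs] at hchain
  rw [mutualInfoNat]
  linarith

theorem robustValue_le_splittingValue [Finite A] [Nonempty A] (hn : 0 < n)
    (hμ : μ ∈ stdSimplex ℝ Ω) (hQ : ∀ x, Q x ∈ stdSimplex ℝ Y)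
    (hσ : σ ∈ senderStrategies Ω X n k) :
    robustValue uS uR μ Q σ ≤
      splittingValue uS uR μ (((k : ℝ) / (n : ℝ) * capacity Q : ℝ) : EReal) := by
  have hn : (0 : ℝ) < n := by exact_mod_cast hn
  have hJ := jointLaw_nonneg hμ hQ hσ
  let J : (Fin k → Y) × Fin n → Ω → ℝ := fun z ω => 1 / n * marginal (jointLaw μ Q σ z.1) z.2 ω
  have hJ0 (z : (Fin k → Y) × Fin n) (ω : Ω) : 0 ≤ J z ω :=
    mul_nonneg (one_div_pos.2 hn).le (marginal_nonneg (hJ z.1) z.2 ω)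
  have hvalue : robustValue uS uR μ Q σ = ∑ z, robustPayoff uS uR (J z) := by
    simp only [J, robustPayoff_const_mul uS uR (one_div_pos.2 hn).le, Fintype.sum_prod_type,
      ← mul_sum, robustValue]
  have hprior (ω : Ω) : ∑ z, J z ω = μ ω := by
    rw [Fintype.sum_prod_type_right]
    simp [J, ← mul_sum, sum_marginal_jointLaw hμ hQ hσ, hn.ne']
  have hsubadditive : ∑ y, massEntropy (jointLaw μ Q σ y) ≤
      ∑ y, ∑ t, massEntropy (marginal (jointLaw μ Q σ y) t) :=
    sum_le_sum fun y _ => massEntropy_le_sum_massEntropy_marginal (hJ y)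
  have hentropy : ∑ z, massEntropy (J z) =
      1 / n * ∑ y, ∑ t, massEntropy (marginal (jointLaw μ Q σ y) t) := by
    simp only [J, mul_sum, Fintype.sum_prod_type]
    exact sum_congr rfl fun y _ => sum_congr rfl fun t _ =>
      massEntropy_const_mul (marginal_nonneg (hJ y) t) _
  have hinputs := outputLaw_mem_stdSimplex (iidLaw_mem_stdSimplex (n := n) hμ) hσ
  have hinfo := (massEntropy_iidLaw_sub_sum_massEntropy_jointLaw_le hμ hQ hσ).trans
    (mutualInfoNat_channelPow_le hQ hinputs)
  refine hvalue.trans_le (sum_robustPayoff_le_splittingValue hμ hJ0 hprior ?_)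
  rw [EReal.coe_le_coe_iff, hentropy, div_le_iff₀ (log_pos one_lt_two)]
  field_simp
  linarith

theorem optimalRobustPayoff_le_splittingValue [Finite A] [Nonempty A] [Nonempty X] (hn : 0 < n)
    (hμ : μ ∈ stdSimplex ℝ Ω) (hQ : ∀ x, Q x ∈ stdSimplex ℝ Y) :
    optimalRobustPayoff uS uR μ Q n k ≤
      splittingValue uS uR μ (((k : ℝ) / (n : ℝ) * capacity Q : ℝ) : EReal) := by
  rw [optimalRobustPayoff_eq_sSup_robustValue hn]
  obtain ⟨p, hp⟩ := nonempty_stdSimplex (X := Fin k → X)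
  refine csSup_le ⟨_, fun _ => p, fun _ => hp, rfl⟩ ?_
  rintro _ ⟨σ, hσ, rfl⟩
  exact robustValue_le_splittingValue hn hμ hQ hσ

end Converse

section Transmission

variable {S I Y : Type*} [Fintype S] [Fintype Y]

theorem sub_two_mul_le_sum_mul_apply [DecidableEq I] {W : Y → ℝ} (hW : W ∈ stdSimplex ℝ Y)
    {g : I → ℝ} {B e : ℝ} (hg : ∀ i, |g i| ≤ B) {d : Y → I} {i : I}
    (he : ∑ y with d y ≠ i, W y ≤ e) :
    g i - 2 * B * e ≤ ∑ y, W y * g (d y) := by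
  have hB : 0 ≤ B := (abs_nonneg _).trans (hg i)
  have hpointwise (y : Y) :
      W y * g i - 2 * B * (if d y ≠ i then W y else 0) ≤ W y * g (d y) := by
    split_ifs with hy
    · have hgap : g i - 2 * B ≤ g (d y) := by
        linarith [(abs_le.1 (hg i)).2, (abs_le.1 (hg (d y))).1]
      linarith [mul_le_mul_of_nonneg_left hgap (hW.1 y)]
    · rw [not_not.1 hy]
      simp
  calc g i - 2 * B * e ≤ g i - 2 * B * ∑ y with d y ≠ i, W y := by gcongr
    _ = ∑ y, (W y * g i - 2 * B * (if d y ≠ i then W y else 0)) := by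
      rw [sum_sub_distrib, ← sum_mul, hW.2, one_mul, ← mul_sum, ← sum_filter]
    _ ≤ ∑ y, W y * g (d y) := sum_le_sum fun y _ => hpointwise y

theorem exists_selector_le_sum_mul [Nonempty I] {q : S → ℝ} (hq : q ∈ stdSimplex ℝ S)
    {g : I → S → ℝ} {B v e : ℝ} [DecidablePred fun s => ∀ i, g i s ≤ v]
    (hg : ∀ i s, |g i s| ≤ B) (hv : v ≤ B)
    (he : ∑ s with ∀ i, g i s ≤ v, q s ≤ e) :
    ∃ f : S → I, v - 2 * B * e ≤ ∑ s, q s * g (f s) s := by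
  have hB : 0 ≤ B := by
    obtain ⟨s, -⟩ := exists_le_of_le_sum_mul (f := 0) (c := 0) hq (by simp)
    exact (abs_nonneg _).trans (hg (Classical.arbitrary I) s)
  have hselect (s : S) : ∃ i, v - 2 * B * (if ∀ i, g i s ≤ v then 1 else 0) ≤ g i s := by
    split_ifs with hbad
    · exact ⟨Classical.arbitrary I, by linarith [(abs_le.1 (hg (Classical.arbitrary I) s)).1]⟩
    · push Not at hbad
      exact hbad.imp fun i hi => by linarith
  choose f hf using hselect
  refine ⟨f, ?_⟩
  calc v - 2 * B * e ≤ v - 2 * B * ∑ s with ∀ i, g i s ≤ v, q s := by gcongr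
    _ = ∑ s, q s * (v - 2 * B * (if ∀ i, g i s ≤ v then 1 else 0)) := by
      simp only [mul_sub, sum_sub_distrib, ← sum_mul, hq.2, one_mul, mul_left_comm _ (2 * B),
        ← mul_sum]
      simp only [mul_boole, sum_filter]
    _ ≤ ∑ s, q s * g (f s) s := sum_le_sum fun s _ => mul_le_mul_of_nonneg_left (hf s) (hq.1 s)

variable [Fintype I] {P : I → S → ℝ}

theorem sum_massEntropy_le_sum_massEntropy_of_channel (hP : ∀ i s, 0 ≤ P i s) {W : I → Y → ℝ}
    (hW : ∀ i, W i ∈ stdSimplex ℝ Y) :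
    ∑ i, massEntropy (P i) ≤ ∑ y, massEntropy (fun s => ∑ i, W i y * P i s) := by
  have hconcave (y : Y) :
      ∑ i, W i y * massEntropy (P i) ≤ massEntropy (fun s => ∑ i, W i y * P i s) := by
    have h := sum_massEntropy_le_massEntropy_sum (q := fun i s => W i y * P i s) fun i s =>
      mul_nonneg ((hW i).1 y) (hP i s)
    simpa only [massEntropy_const_mul (hP _)] using h
  calc ∑ i, massEntropy (P i) = ∑ y, ∑ i, W i y * massEntropy (P i) := by
        rw [sum_comm]
        simp [← sum_mul, (hW _).2]
    _ ≤ _ := sum_le_sum fun y _ => hconcave y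

theorem sum_sum_mul_sub_le_sum_sum_mul_apply [DecidableEq I] (hP : ∀ i s, 0 ≤ P i s)
    (hP1 : ∑ i, ∑ s, P i s = 1) {W : I → Y → ℝ} (hW : ∀ i, W i ∈ stdSimplex ℝ Y)
    {g : I → S → ℝ} {B e : ℝ} (hg : ∀ i s, |g i s| ≤ B) {d : Y → I}
    (he : ∀ i, ∑ y with d y ≠ i, W i y ≤ e) :
    ∑ i, ∑ s, P i s * g i s - 2 * B * e ≤
      ∑ y, ∑ s, (∑ i, W i y * P i s) * g (d y) s := by
  calc ∑ i, ∑ s, P i s * g i s - 2 * B * e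
      = ∑ i, ∑ s, P i s * (g i s - 2 * B * e) := by
        simp only [mul_sub, sum_sub_distrib, ← sum_mul, hP1, one_mul]
    _ ≤ ∑ i, ∑ s, P i s * ∑ y, W i y * g (d y) s := by
        gcongr with i _ s _
        · exact hP i s
        · exact sub_two_mul_le_sum_mul_apply (hW i) (hg · s) (he i)
    _ = ∑ y, ∑ s, (∑ i, W i y * P i s) * g (d y) s := by
        simp only [sum_mul, mul_sum]
        rw [sum_comm, sum_comm (s := (univ : Finset Y))]
        refine sum_congr rfl fun s _ => sum_comm.trans ?_
        exact sum_congr rfl fun y _ => sum_congr rfl fun i _ => by ring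

theorem massEntropy_sum_sub_log_card_le (hP : ∀ i s, 0 ≤ P i s)
    (hP1 : (fun i => ∑ s, P i s) ∈ stdSimplex ℝ I) :
    massEntropy (fun s => ∑ i, P i s) - log (Fintype.card I) ≤ ∑ i, massEntropy (P i) := by
  have hchain := massEntropy_add_sum_massEntropy_comm P
  have hnonneg : 0 ≤ ∑ s, massEntropy (fun i => P i s) :=
    sum_nonneg fun s _ => massEntropy_nonneg fun i => hP i s
  linarith [massEntropy_le_log_card hP1]

end Transmission

section Score

variable {Ω A : Type*} [Fintype Ω] {uS uR : Ω → A → ℝ} {K ε : ℝ} {ν : Ω → ℝ}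

/-- The score of the state `ω` under the intended posterior `ν`. Its expectation under a belief `q`
is the intended payoff minus `K` times the cross entropy, so a word whose total score is near its
mean both promises the right payoff and keeps the realized beliefs close to the intended ones. -/
def score (uS uR : Ω → A → ℝ) (K : ℝ) (ν : Ω → ℝ) (ω : Ω) : ℝ :=
  robustPayoff uS uR ν + K * log (ν ω)

/-- A quantitative form of lower semicontinuity of the robust payoff at `ν`: its decrease at another
belief is at most `ε` plus `K` times the divergence of that belief from `ν`. -/
def IsStableBelief (uS uR : Ω → A → ℝ) (ε K : ℝ) (ν : Ω → ℝ) : Prop :=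
  ∀ q ∈ supportedBeliefs ν,
    robustPayoff uS uR ν - ε - K * divergence q ν ≤ robustPayoff uS uR q

theorem sum_mul_score (q : Ω → ℝ) : ∑ ω, q ω * score uS uR K ν ω =
    (∑ ω, q ω) * robustPayoff uS uR ν - K * crossEntropy q ν := by
  simp only [score, crossEntropy, mul_add, sum_add_distrib, ← sum_mul, mul_left_comm _ K,
    ← mul_sum]
  ring

theorem sum_mul_score_self (hν : ν ∈ stdSimplex ℝ Ω) :
    ∑ ω, ν ω * score uS uR K ν ω = robustPayoff uS uR ν - K * massEntropy ν := by
  rw [sum_mul_score, hν.2, one_mul]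
  simp [crossEntropy, massEntropy, hν.2]

theorem exists_forall_abs_score_le {ι : Type*} [Finite ι] (uS uR : Ω → A → ℝ) (K : ℝ)
    (ν : ι → Ω → ℝ) : ∃ B : ℝ, 0 ≤ B ∧ ∀ m ω, |score uS uR K (ν m) ω| ≤ B := by
  obtain ⟨B, hB⟩ := exists_forall_abs_le fun m ω => score uS uR K (ν m) ω
  exact ⟨|B|, abs_nonneg B, fun m ω => (hB m ω).trans (le_abs_self B)⟩

variable [Finite A] [Nonempty A]

theorem exists_forall_isStableBelief {ι : Type*} [Finite ι] {ν : ι → Ω → ℝ}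
    (uS uR : Ω → A → ℝ) (hν : ∀ i, ν i ∈ stdSimplex ℝ Ω) (hε : 0 < ε) :
    ∃ K : ℝ, 0 ≤ K ∧ ∀ m, IsStableBelief uS uR ε K (ν m) := by
  have := Fintype.ofFinite ι
  obtain ⟨B, hB⟩ := exists_forall_abs_robustPayoff_le uS uR
  choose K hK0 hK using fun m => exists_sub_mul_divergence_le hB (hν m) hε
    ((lowerSemicontinuous_robustPayoff uS uR).lowerSemicontinuousWithinAt _ (ν m))
  refine ⟨∑ m, K m, sum_nonneg fun m _ => hK0 m, fun m q hq => (hK m q hq).trans' ?_⟩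
  have hdiv := divergence_nonneg hq.1.1 (hν m).1 hq.2 (hν m).2.le
  gcongr
  exact single_le_sum (fun m _ => hK0 m) (mem_univ m)

theorem sum_mul_score_sub_add_massEntropy_le_robustPayoff
    (hstable : IsStableBelief uS uR ε K ν)
    (hν : ν ∈ stdSimplex ℝ Ω) {q : Ω → ℝ} (hq : ∀ ω, 0 ≤ q ω) (hqν : ∀ ω, ν ω = 0 → q ω = 0) :
    ∑ ω, q ω * score uS uR K ν ω - ε * ∑ ω, q ω + K * massEntropy q ≤ robustPayoff uS uR q := by
  obtain ⟨q', hq', hqq'⟩ := exists_mem_stdSimplex_sum_mul_eq hν hq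
  set Z := ∑ ω, q ω
  have hZ0 : 0 ≤ Z := sum_nonneg fun ω _ => hq ω
  have hcross : crossEntropy q ν = Z * crossEntropy q' ν := by
    rw [hqq']
    simp only [crossEntropy, mul_assoc, ← mul_sum, mul_neg]
  rw [sum_mul_score, hcross, hqq', massEntropy_const_mul hq'.1, robustPayoff_const_mul _ _ hZ0,
    ← hqq']
  have hscaled : Z * (robustPayoff uS uR ν - ε - K * divergence q' ν) ≤
      Z * robustPayoff uS uR q' := by
    rcases hZ0.eq_or_lt with hZ | hZ
    · simp [← hZ]
    · refine mul_le_mul_of_nonneg_left (hstable q' ⟨hq', fun ω hω => ?_⟩) hZ0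
      have hqω := congrFun hqq' ω
      rw [hqν ω hω, eq_comm] at hqω
      exact (mul_eq_zero.1 hqω).resolve_left hZ.ne'
  rw [divergence] at hscaled
  linarith

theorem sum_mul_sum_score_sub_add_massEntropy_le_sum_robustPayoff_marginal {n : ℕ}
    {ν : Fin n → Ω → ℝ} (hν : ∀ t, ν t ∈ stdSimplex ℝ Ω) (hK : 0 ≤ K)
    (hstable : ∀ t, IsStableBelief uS uR ε K (ν t))
    {q : (Fin n → Ω) → ℝ} (hq : ∀ ω, 0 ≤ q ω) (hqν : ∀ t ω, ν t ω = 0 → marginal q t ω = 0) :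
    ∑ ω, q ω * ∑ t, score uS uR K (ν t) (ω t) - n * ε * ∑ ω, q ω + K * massEntropy q ≤
      ∑ t, robustPayoff uS uR (marginal q t) := by
  have hscore : ∑ ω, q ω * ∑ t, score uS uR K (ν t) (ω t) =
      ∑ t, ∑ ω, marginal q t ω * score uS uR K (ν t) ω := by
    simp only [sum_marginal_mul, mul_sum]
    exact sum_comm
  calc ∑ ω, q ω * ∑ t, score uS uR K (ν t) (ω t) - n * ε * ∑ ω, q ω + K * massEntropy q
      ≤ ∑ t, ∑ ω, marginal q t ω * score uS uR K (ν t) ω - n * ε * ∑ ω, q ω +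
          K * ∑ t, massEntropy (marginal q t) := by
        rw [hscore]
        gcongr
        exact massEntropy_le_sum_massEntropy_marginal hq
    _ = ∑ t, (∑ ω, marginal q t ω * score uS uR K (ν t) ω - ε * ∑ ω, marginal q t ω +
          K * massEntropy (marginal q t)) := by
        simp [sum_add_distrib, sum_sub_distrib, sum_marginal, mul_sum, mul_assoc]
    _ ≤ _ := sum_le_sum fun t _ => sum_mul_score_sub_add_massEntropy_le_robustPayoff (hstable t)
        (hν t) (marginal_nonneg hq t) (hqν t)

end Score

section Encoder

variable {Ω A X Y I : Type*} [Fintype X] [Fintype I] {uS uR : Ω → A → ℝ} {μ : Ω → ℝ}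
  {Q : X → Y → ℝ} {n k : ℕ}

/-- The sender draws a message `i` conditionally on the states `ω` and transmits its codeword. -/
theorem exists_senderStrategy_jointLaw_eq [Nonempty I] {P : I → (Fin n → Ω) → ℝ}
    (hP : ∀ i ω, 0 ≤ P i ω) (hPμ : ∀ ω, ∑ i, P i ω = iidLaw μ ω) (Q : X → Y → ℝ)
    (c : I → Fin k → X) :
    ∃ σ ∈ senderStrategies Ω X n k, ∀ y ω,
      jointLaw μ Q σ y ω = ∑ i, channelPow Q (c i) y * P i ω := by
  classical
  obtain ⟨p, hp⟩ := nonempty_stdSimplex (X := I)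
  choose κ hκ hPκ using fun ω => exists_mem_stdSimplex_sum_mul_eq hp fun i => hP i ω
  refine ⟨fun ω => outputLaw (κ ω) fun i => Pi.single (c i) 1, fun ω =>
    outputLaw_mem_stdSimplex (hκ ω) fun i => single_mem_stdSimplex ℝ (c i), fun y ω => ?_⟩
  have hdraw (i : I) : P i ω = iidLaw μ ω * κ ω i := by rw [← hPμ, ← congrFun (hPκ ω) i]
  simp only [jointLaw, outputLaw, hdraw, mul_sum, sum_mul]
  rw [sum_comm]
  refine sum_congr rfl fun i _ => ?_
  simp [Pi.single_apply, mul_comm]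

variable [Fintype Ω] [Fintype Y]

theorem marginal_jointLaw_eq_zero {σ : (Fin n → Ω) → (Fin k → X) → ℝ} (hμ : μ ∈ stdSimplex ℝ Ω)
    (hQ : ∀ x, Q x ∈ stdSimplex ℝ Y) (hσ : σ ∈ senderStrategies Ω X n k) {ω : Ω} (hω : μ ω = 0)
    (y : Fin k → Y) (t : Fin n) : marginal (jointLaw μ Q σ y) t ω = 0 := by
  rw [← sum_marginal_jointLaw hμ hQ hσ t ω, sum_eq_zero_iff_of_nonneg fun y _ =>
    marginal_nonneg (jointLaw_nonneg hμ hQ hσ y) t ω] at hω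
  exact hω y (mem_univ y)

variable [Finite A] [Nonempty A]

theorem robustPayoff_le_optimalRobustPayoff [Nonempty X] (hn : 0 < n) (hμ : μ ∈ stdSimplex ℝ Ω)
    (hQ : ∀ x, Q x ∈ stdSimplex ℝ Y) :
    robustPayoff uS uR μ ≤ optimalRobustPayoff uS uR μ Q n k := by
  let x : Fin k → X := fun _ => Classical.arbitrary X
  obtain ⟨σ, hσ, hJ⟩ := exists_senderStrategy_jointLaw_eq (μ := μ) (n := n) (I := Unit)
    (P := fun _ => iidLaw μ) (fun _ => (iidLaw_mem_stdSimplex hμ).1) (by simp) Q fun _ => x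
  have hmarginal (y : Fin k → Y) (t : Fin n) :
      marginal (jointLaw μ Q σ y) t = fun ω => channelPow Q x y * μ ω := by
    funext ω
    rw [← congrFun (marginal_iidLaw hμ t) ω]
    simp [marginal, hJ, mul_sum]
  have hchannel := channelPow_mem_stdSimplex hQ x
  refine le_of_eq_of_le ?_ (robustValue_le_optimalRobustPayoff hn hμ hQ hσ)
  simp only [robustValue, hmarginal, robustPayoff_const_mul uS uR (hchannel.1 _), sum_const,
    card_univ, Fintype.card_fin, nsmul_eq_mul, ← mul_sum, ← sum_mul, hchannel.2]
  field_simp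

/-- `P` is the joint law of the message and the states, `w i` is the word of intended posteriors of
the message `i`, and `(c, d)` is a channel code for the messages. -/
theorem sum_mul_sum_score_sub_le_mul_optimalRobustPayoff [Nonempty I] [DecidableEq I]
    {ι : Type*} {ν : ι → Ω → ℝ} (hn : 0 < n) (hμ : μ ∈ stdSimplex ℝ Ω)
    (hQ : ∀ x, Q x ∈ stdSimplex ℝ Y) (hν : ∀ m, ν m ∈ stdSimplex ℝ Ω)
    (hfull : ∀ m ω, ν m ω = 0 → μ ω = 0) {K ε B e : ℝ} (hK : 0 ≤ K)
    (hstable : ∀ m, IsStableBelief uS uR ε K (ν m))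
    (hB : ∀ m ω, |score uS uR K (ν m) ω| ≤ B) {P : I → (Fin n → Ω) → ℝ}
    (hP : ∀ i ω, 0 ≤ P i ω) (hPμ : ∀ ω, ∑ i, P i ω = iidLaw μ ω)
    (c : I → Fin k → X) (d : (Fin k → Y) → I)
    (he : ∀ i, ∑ y with d y ≠ i, channelPow Q (c i) y ≤ e) (w : I → Fin n → ι) :
    ∑ i, ∑ ω, P i ω * ∑ t, score uS uR K (ν (w i t)) (ω t) + K * ∑ i, massEntropy (P i) -
      n * (ε + 2 * B * e) ≤ n * optimalRobustPayoff uS uR μ Q n k := by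
  obtain ⟨σ, hσ, hJ⟩ := exists_senderStrategy_jointLaw_eq hP hPμ Q c
  have hJ0 := jointLaw_nonneg hμ hQ hσ
  set s : I → (Fin n → Ω) → ℝ := fun i ω => ∑ t, score uS uR K (ν (w i t)) (ω t)
  have hs (i : I) (ω : Fin n → Ω) : |s i ω| ≤ n * B :=
    (abs_sum_le_sum_abs _ _).trans ((sum_le_sum fun t _ => hB _ _).trans_eq (by simp))
  have hP1 : ∑ i, ∑ ω, P i ω = 1 := by
    rw [sum_comm]
    simp only [hPμ, (iidLaw_mem_stdSimplex hμ).2]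
  have hdecoded : ∑ i, ∑ ω, P i ω * s i ω - 2 * (n * B) * e ≤
      ∑ y, ∑ ω, jointLaw μ Q σ y ω * s (d y) ω := by
    simpa only [← hJ] using sum_sum_mul_sub_le_sum_sum_mul_apply hP hP1
      (fun i => channelPow_mem_stdSimplex hQ (c i)) hs he
  have hentropy : ∑ i, massEntropy (P i) ≤ ∑ y, massEntropy (jointLaw μ Q σ y) := by
    simpa only [← hJ] using sum_massEntropy_le_sum_massEntropy_of_channel hP fun i =>
      channelPow_mem_stdSimplex hQ (c i)
  have hpayoff := sum_le_sum fun y (_ : y ∈ univ) =>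
    sum_mul_sum_score_sub_add_massEntropy_le_sum_robustPayoff_marginal (fun t => hν (w (d y) t))
      hK (fun t => hstable _) (hJ0 y) fun t ω hω =>
        marginal_jointLaw_eq_zero hμ hQ hσ (hfull _ ω hω) y t
  simp only [sum_add_distrib, sum_sub_distrib, ← mul_sum, sum_sum_jointLaw hμ hQ hσ] at hpayoff
  have hvalue : ∑ y, ∑ t, robustPayoff uS uR (marginal (jointLaw μ Q σ y) t) ≤
      n * optimalRobustPayoff uS uR μ Q n k := by
    have hn : (0 : ℝ) < n := by exact_mod_cast hn
    rw [← div_le_iff₀' hn, ← one_div_mul_eq_div]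
    exact robustValue_le_optimalRobustPayoff (by exact_mod_cast hn) hμ hQ hσ
  linarith [mul_le_mul_of_nonneg_left hentropy hK]

end Encoder

section Memoryless

variable {S T : Type*} [Fintype S] [Fintype T] {p : S → ℝ} {W : S → T → ℝ}

theorem sum_sum_iidLaw_mul_channelPow_mul_sum (hp : p ∈ stdSimplex ℝ S)
    (hW : ∀ s, W s ∈ stdSimplex ℝ T) (F : S → T → ℝ) (n : ℕ) :
    ∑ x : Fin n → S, ∑ y, iidLaw p x * channelPow W x y * ∑ t, F (x t) (y t) =
      n * ∑ s, p s * ∑ s', W s s' * F s s' := by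
  have hcoordinate (x : Fin n → S) : ∑ y, channelPow W x y * ∑ t, F (x t) (y t) =
      ∑ t, ∑ s', W (x t) s' * F (x t) s' := by
    simp only [mul_sum]
    rw [sum_comm]
    refine sum_congr rfl fun t _ => ?_
    have hmarginal : marginal (channelPow W x) t = W (x t) :=
      marginal_prod (p := fun t => W (x t)) (fun t => hW _) t
    rw [← sum_marginal_mul, hmarginal]
  simp only [mul_assoc, ← mul_sum, hcoordinate]
  exact sum_iidLaw_mul_sum hp (fun s => ∑ s', W s s' * F s s') n

theorem sum_massEntropy_iidLaw_mul_channelPow (hp : p ∈ stdSimplex ℝ S)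
    (hW : ∀ s, W s ∈ stdSimplex ℝ T) (n : ℕ) :
    ∑ x : Fin n → S, massEntropy (fun y => iidLaw p x * channelPow W x y) =
      n * ∑ s, p s * massEntropy (W s) := by
  rw [← sum_iidLaw_mul_sum hp]
  refine sum_congr rfl fun x _ => ?_
  rw [massEntropy_const_mul (channelPow_mem_stdSimplex hW x).1]
  exact congrArg _ (massEntropy_prod (p := fun t => W (x t)) fun t => hW (x t))

end Memoryless

section Achievability

variable {Ω A : Type*} [Fintype Ω] {uS uR : Ω → A → ℝ} {μ : Ω → ℝ} {M : ℕ} {lam : Fin M → ℝ}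
  {ν : Fin M → Ω → ℝ} {n k : ℕ} {K ε B e ρ : ℝ}

theorem IsSplitting.nonempty (hs : IsSplitting μ lam ν) : Nonempty (Fin M) := by
  obtain ⟨m, -⟩ := exists_le_of_le_sum_mul (f := 0) (c := 0) hs.weights (by simp)
  exact ⟨m⟩

theorem IsSplitting.sum_mul_sum_mul_score (hs : IsSplitting μ lam ν) :
    ∑ m, lam m * ∑ ω, ν m ω * score uS uR K (ν m) ω =
      ∑ m, lam m * robustPayoff uS uR (ν m) - K * ∑ m, lam m * massEntropy (ν m) := by
  simp only [sum_mul_score_self (hs.posteriors _), mul_sub, sum_sub_distrib, mul_left_comm _ K,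
    ← mul_sum]

theorem IsSplitting.sum_mul_sum_mul_score_le (hs : IsSplitting μ lam ν)
    (hB : ∀ m ω, |score uS uR K (ν m) ω| ≤ B) :
    ∑ m, lam m * ∑ ω, ν m ω * score uS uR K (ν m) ω ≤ B :=
  calc ∑ m, lam m * ∑ ω, ν m ω * score uS uR K (ν m) ω ≤ ∑ m, lam m * ∑ ω, ν m ω * B := by
        gcongr with m _ ω _
        · exact hs.weights.1 m
        · exact (hs.posteriors m).1 ω
        · exact le_of_abs_le (hB m ω)
    _ = B := by simp [← sum_mul, (hs.posteriors _).2, hs.weights.2]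

theorem eventually_exists_nat_mem_Icc_exp {R : ℝ} (hR : 0 ≤ R) (hρ : 0 < ρ) :
    ∀ᶠ n : ℕ in atTop, ∃ L : ℕ, (L : ℝ) ∈ Set.Icc (exp (n * R)) (exp (n * (R + ρ))) := by
  have hgrowth : Tendsto (fun n : ℕ => exp (n * ρ)) atTop atTop :=
    tendsto_exp_atTop.comp (tendsto_natCast_atTop_atTop.atTop_mul_const hρ)
  filter_upwards [hgrowth.eventually_ge_atTop 2] with n hn
  refine ⟨⌈exp (n * R)⌉₊, Nat.le_ceil _, (Nat.ceil_lt_add_one (exp_pos _).le).le.trans ?_⟩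
  have hone : 1 ≤ exp (n * R) := one_le_exp (by positivity)
  calc exp (n * R) + 1 ≤ exp (n * R) * 2 := by linarith
    _ ≤ exp (n * R) * exp (n * ρ) := by gcongr
    _ = exp (n * (R + ρ)) := by rw [← exp_add, mul_add]

theorem eventually_forall_mul_le_imp {p : ℕ → Prop} (hp : ∀ᶠ k in atTop, p k) {r : ℝ}
    (hr : 0 < r) : ∀ᶠ n : ℕ in atTop, ∀ k : ℕ, r * n ≤ k → p k := by
  obtain ⟨k₀, hk₀⟩ := eventually_atTop.1 hp
  filter_upwards [(tendsto_natCast_atTop_atTop.const_mul_atTop hr).eventually_ge_atTop (k₀ : ℝ)]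
    with n hn k hk
  exact hk₀ k (by exact_mod_cast hn.trans hk)

variable {X Y : Type*} [Fintype X] [Fintype Y] {Q : X → Y → ℝ} [Finite A] [Nonempty A]

theorem IsSplitting.sum_mul_robustPayoff_sub_le_optimalRobustPayoff_of_random_encoder
    (hs : IsSplitting μ lam ν) (hn : 0 < n) (hQ : ∀ x, Q x ∈ stdSimplex ℝ Y)
    (hfull : ∀ m ω, ν m ω = 0 → μ ω = 0) (hK : 0 ≤ K)
    (hstable : ∀ m, IsStableBelief uS uR ε K (ν m))
    (hB : ∀ m ω, |score uS uR K (ν m) ω| ≤ B) (c : (Fin n → Fin M) → Fin k → X)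
    (d : (Fin k → Y) → Fin n → Fin M)
    (he : ∀ i, ∑ y with d y ≠ i, channelPow Q (c i) y ≤ e) :
    ∑ m, lam m * robustPayoff uS uR (ν m) - (ε + 2 * B * e) ≤
      optimalRobustPayoff uS uR μ Q n k := by
  have := hs.nonempty
  have hencoder := sum_mul_sum_score_sub_le_mul_optimalRobustPayoff hn hs.mem_stdSimplex hQ
    hs.posteriors hfull hK hstable hB
    (fun i ω => iidLaw_mul_channelPow_nonneg hs.weights hs.posteriors i ω)
    (fun ω => (outputLaw_channelPow ω).trans (by rw [hs.outputLaw_eq])) c d he id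
  simp only [id, sum_massEntropy_iidLaw_mul_channelPow hs.weights hs.posteriors,
    sum_sum_iidLaw_mul_channelPow_mul_sum hs.weights hs.posteriors fun m => score uS uR K (ν m),
    hs.sum_mul_sum_mul_score] at hencoder
  refine le_of_mul_le_mul_left ?_ (show (0 : ℝ) < n by exact_mod_cast hn)
  linarith

theorem IsSplitting.eventually_le_optimalRobustPayoff_of_capacity_pos [Nonempty X]
    (hs : IsSplitting μ lam ν) (hfull : ∀ m ω, ν m ω = 0 → μ ω = 0)
    (hQ : ∀ x, Q x ∈ stdSimplex ℝ Y) (hC : 0 < capacity Q) (hε : 0 < ε) (hn : 0 < n) :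
    ∀ᶠ k in atTop, ∑ m, lam m * robustPayoff uS uR (ν m) - ε ≤
      optimalRobustPayoff uS uR μ Q n k := by
  classical
  have := hs.nonempty
  obtain ⟨K, hK, hstable⟩ := exists_forall_isStableBelief uS uR hs.posteriors (half_pos hε)
  obtain ⟨B, hB0, hB⟩ := exists_forall_abs_score_le uS uR K ν
  obtain ⟨p, hp, hinfo⟩ := exists_lt_mutualInfoNat hQ (mul_pos hC (log_pos one_lt_two))
  have hrate : Tendsto (fun k : ℕ => exp (k * (mutualInfoNat p Q / 2))) atTop atTop :=
    tendsto_exp_atTop.comp (tendsto_natCast_atTop_atTop.atTop_mul_const (half_pos hinfo))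
  filter_upwards [hrate.eventually_ge_atTop (Fintype.card (Fin n → Fin M) : ℝ),
    eventually_exists_channel_code hp hQ (half_lt_self hinfo)
      (show 0 < ε / (4 * B + 1) by positivity)] with k hcard hcode
  obtain ⟨c, d, hcd⟩ := hcode _ hcard
  have hguarantee := hs.sum_mul_robustPayoff_sub_le_optimalRobustPayoff_of_random_encoder
    hn hQ hfull hK hstable hB c d hcd
  have herror : 2 * B * (ε / (4 * B + 1)) ≤ ε / 2 := by
    rw [mul_div_assoc', div_le_div_iff₀ (by positivity) two_pos]
    linarith
  linarith

theorem sum_iidLaw_mul_sum_score_sub_le_mul_optimalRobustPayoff {I ι : Type*} [Fintype I]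
    [Nonempty I] [DecidableEq I] {ν : ι → Ω → ℝ} (hn : 0 < n) (hμ : μ ∈ stdSimplex ℝ Ω)
    (hQ : ∀ x, Q x ∈ stdSimplex ℝ Y) (hν : ∀ m, ν m ∈ stdSimplex ℝ Ω)
    (hfull : ∀ m ω, ν m ω = 0 → μ ω = 0) (hK : 0 ≤ K)
    (hstable : ∀ m, IsStableBelief uS uR ε K (ν m))
    (hB : ∀ m ω, |score uS uR K (ν m) ω| ≤ B) (c : I → Fin k → X) (d : (Fin k → Y) → I)
    (he : ∀ i, ∑ y with d y ≠ i, channelPow Q (c i) y ≤ e) (w : I → Fin n → ι)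
    (f : (Fin n → Ω) → I) :
    ∑ ω, iidLaw μ ω * ∑ t, score uS uR K (ν (w (f ω) t)) (ω t) +
      K * (n * massEntropy μ - log (Fintype.card I)) - n * (ε + 2 * B * e) ≤
        n * optimalRobustPayoff uS uR μ Q n k := by
  have hiid := iidLaw_mem_stdSimplex (n := n) hμ
  set P : I → (Fin n → Ω) → ℝ := fun i ω => if f ω = i then iidLaw μ ω else 0 with hP_def
  have hP (i : I) (ω : Fin n → Ω) : 0 ≤ P i ω := by
    simp only [hP_def]
    split_ifs
    exacts [hiid.1 ω, le_rfl]
  have hPμ (ω : Fin n → Ω) : ∑ i, P i ω = iidLaw μ ω := by simp [hP_def]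
  have hencoder := sum_mul_sum_score_sub_le_mul_optimalRobustPayoff hn hμ hQ hν hfull hK hstable hB
    hP hPμ c d he w
  have hscore : ∑ i, ∑ ω, P i ω * ∑ t, score uS uR K (ν (w i t)) (ω t) =
      ∑ ω, iidLaw μ ω * ∑ t, score uS uR K (ν (w (f ω) t)) (ω t) := by
    rw [sum_comm]
    simp [hP_def]
  have hentropy := massEntropy_sum_sub_log_card_le hP
    ⟨fun i => sum_nonneg fun ω _ => hP i ω, by rw [sum_comm]; simp only [hPμ, hiid.2]⟩
  simp only [hPμ, massEntropy_iidLaw hμ] at hentropy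
  linarith [mul_le_mul_of_nonneg_left hentropy hK]

theorem IsSplitting.sum_mul_robustPayoff_sub_le_optimalRobustPayoff_of_source_code
    (hs : IsSplitting μ lam ν) (hn : 0 < n) (hQ : ∀ x, Q x ∈ stdSimplex ℝ Y)
    (hfull : ∀ m ω, ν m ω = 0 → μ ω = 0) (hK : 0 ≤ K)
    (hstable : ∀ m, IsStableBelief uS uR ε K (ν m))
    (hB : ∀ m ω, |score uS uR K (ν m) ω| ≤ B) {I : Type*} [Fintype I] [Nonempty I]
    [DecidableEq I]
    (hcard : log (Fintype.card I) ≤ n * (mutualInfoNat lam ν + ρ)) (he0 : 0 ≤ e)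
    (c : I → Fin k → X) (d : (Fin k → Y) → I)
    (he : ∀ i, ∑ y with d y ≠ i, channelPow Q (c i) y ≤ e) (w : I → Fin n → Fin M)
    (hw : ∑ ω with ∀ i, ∑ t, score uS uR K (ν (w i t)) (ω t) ≤
      n * (∑ m, lam m * ∑ ω, ν m ω * score uS uR K (ν m) ω - e), iidLaw μ ω ≤ e) :
    ∑ m, lam m * robustPayoff uS uR (ν m) - (ε + (1 + 4 * B) * e + K * ρ) ≤
      optimalRobustPayoff uS uR μ Q n k := by
  have hμ := hs.mem_stdSimplex
  have hscore (i : I) (ω : Fin n → Ω) : |∑ t, score uS uR K (ν (w i t)) (ω t)| ≤ n * B :=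
    (abs_sum_le_sum_abs _ _).trans ((sum_le_sum fun t _ => hB _ _).trans_eq (by simp))
  have htarget : n * (∑ m, lam m * ∑ ω, ν m ω * score uS uR K (ν m) ω - e) ≤ n * B := by
    gcongr
    linarith [hs.sum_mul_sum_mul_score_le hB]
  obtain ⟨f, hf⟩ := exists_selector_le_sum_mul (iidLaw_mem_stdSimplex hμ) hscore htarget hw
  have hencoder := sum_iidLaw_mul_sum_score_sub_le_mul_optimalRobustPayoff hn hμ hQ hs.posteriors
    hfull hK hstable hB c d he w f
  rw [hs.sum_mul_sum_mul_score] at hf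
  rw [mutualInfoNat, hs.outputLaw_eq] at hcard
  refine le_of_mul_le_mul_left ?_ (show (0 : ℝ) < n by exact_mod_cast hn)
  linarith [mul_le_mul_of_nonneg_left hcard hK]

theorem IsSplitting.eventually_le_optimalRobustPayoff [Nonempty X] (hs : IsSplitting μ lam ν)
    (hfull : ∀ m ω, ν m ω = 0 → μ ω = 0) (hQ : ∀ x, Q x ∈ stdSimplex ℝ Y) {r : ℝ} (hr : 0 < r)
    (hinfo : mutualInfoNat lam ν < r * (capacity Q * log 2)) (hε : 0 < ε) :
    ∀ᶠ n : ℕ in atTop, ∀ k : ℕ, r * n ≤ k →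
      ∑ m, lam m * robustPayoff uS uR (ν m) - ε ≤ optimalRobustPayoff uS uR μ Q n k := by
  classical
  obtain ⟨K, hK, hstable⟩ := exists_forall_isStableBelief uS uR hs.posteriors (half_pos hε)
  obtain ⟨B, hB0, hB⟩ := exists_forall_abs_score_le uS uR K ν
  rw [mul_comm, ← div_lt_iff₀ hr] at hinfo
  obtain ⟨R, hRinfo, hRcap⟩ := exists_between hinfo
  obtain ⟨p, hp, hRp⟩ := exists_lt_mutualInfoNat hQ hRcap
  have hinfo0 := mutualInfoNat_nonneg hs.weights hs.posteriors
  have hR : 0 < R := (div_nonneg hinfo0 hr.le).trans_lt hRinfo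
  rw [div_lt_iff₀ hr] at hRinfo
  obtain ⟨δ, hδ0, hδrate, hδε⟩ : ∃ δ : ℝ, 0 < δ ∧ mutualInfoNat lam ν + 2 * δ ≤ R * r ∧
      (1 + 4 * B + 2 * K) * δ ≤ ε / 2 := by
    refine ⟨min ((R * r - mutualInfoNat lam ν) / 2) (ε / 2 / (1 + 4 * B + 2 * K)),
      lt_min (by linarith) (by positivity), ?_, ?_⟩
    · linarith [min_le_left ((R * r - mutualInfoNat lam ν) / 2) (ε / 2 / (1 + 4 * B + 2 * K))]
    · exact (le_div_iff₀' (by positivity)).1 (min_le_right _ _)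
  filter_upwards [eventually_gt_atTop 0,
    eventually_forall_mul_le_imp (eventually_exists_channel_code hp hQ hRp hδ0) hr,
    eventually_exists_source_code hs.weights hs.posteriors (fun m => score uS uR K (ν m))
      (lt_add_of_pos_right _ hδ0) hδ0,
    eventually_exists_nat_mem_Icc_exp (add_nonneg hinfo0 hδ0.le) hδ0]
    with n hn hchannel hsource ⟨L, hLlower, hLupper⟩ k hk
  have hLpos : (0 : ℝ) < L := (exp_pos _).trans_le hLlower
  have : Nonempty (Fin L) := ⟨⟨0, by exact_mod_cast hLpos⟩⟩
  rw [add_assoc, ← two_mul] at hLupper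
  have hrate : n * (mutualInfoNat lam ν + 2 * δ) ≤ k * R := by
    calc n * (mutualInfoNat lam ν + 2 * δ) ≤ n * (R * r) := by gcongr
      _ = (r * n) * R := by ring
      _ ≤ k * R := by gcongr
  obtain ⟨c, d, hcd⟩ := hchannel k hk (Fin L) (by simpa using hLupper.trans (exp_le_exp.2 hrate))
  obtain ⟨w, hw⟩ := hsource L hLlower
  rw [hs.outputLaw_eq] at hw
  have hguarantee := hs.sum_mul_robustPayoff_sub_le_optimalRobustPayoff_of_source_code hn hQ hfull
    hK hstable hB (by rwa [Fintype.card_fin, log_le_iff_le_exp hLpos]) hδ0.le c d hcd w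
    (by convert hw)
  linarith

end Achievability

section FullSupport

variable {Ω A : Type*} [Fintype Ω] {uS uR : Ω → A → ℝ} {μ : Ω → ℝ} {M : ℕ} {lam : Fin M → ℝ}
  {ν : Fin M → Ω → ℝ} {δ : ℝ}

theorem IsSplitting.mix_prior (hs : IsSplitting μ lam ν) (hδ0 : 0 ≤ δ) (hδ1 : δ ≤ 1) :
    IsSplitting μ lam fun m ω => (1 - δ) * ν m ω + δ * μ ω := by
  refine ⟨hs.weights, fun m => convex_stdSimplex ℝ Ω (hs.posteriors m) hs.mem_stdSimplex
    (sub_nonneg.2 hδ1) hδ0 (by ring), fun ω => ?_⟩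
  simp only [mul_add, sum_add_distrib, ← sum_mul, hs.weights.2, mul_left_comm _ (1 - δ), ← mul_sum,
    hs.average]
  ring

theorem IsSplitting.mutualInfoNat_mix_prior_le (hs : IsSplitting μ lam ν) (hδ0 : 0 ≤ δ)
    (hδ1 : δ ≤ 1) :
    mutualInfoNat lam (fun m ω => (1 - δ) * ν m ω + δ * μ ω) ≤ (1 - δ) * mutualInfoNat lam ν := by
  have hμ := hs.mem_stdSimplex
  have hconcave (m : Fin M) : (1 - δ) * massEntropy (ν m) + δ * massEntropy μ ≤
      massEntropy fun ω => (1 - δ) * ν m ω + δ * μ ω := by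
    have h := sum_massEntropy_le_massEntropy_sum
      (q := ![fun ω => (1 - δ) * ν m ω, fun ω => δ * μ ω]) (Fin.forall_fin_two.2
        ⟨fun ω => mul_nonneg (sub_nonneg.2 hδ1) ((hs.posteriors m).1 ω),
          fun ω => mul_nonneg hδ0 (hμ.1 ω)⟩)
    simpa [Fin.sum_univ_two, massEntropy_const_mul (hs.posteriors m).1,
      massEntropy_const_mul hμ.1] using h
  have haverage := sum_le_sum fun m (_ : m ∈ univ) =>
    mul_le_mul_of_nonneg_left (hconcave m) (hs.weights.1 m)
  simp only [mul_add, sum_add_distrib, ← sum_mul, hs.weights.2, mul_left_comm _ (1 - δ),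
    ← mul_sum] at haverage
  rw [mutualInfoNat, mutualInfoNat, hs.outputLaw_eq, (hs.mix_prior hδ0 hδ1).outputLaw_eq]
  linarith

theorem IsSplitting.eventually_lt_sum_mul_robustPayoff_mix_prior [Finite A] [Nonempty A]
    (hs : IsSplitting μ lam ν) {v : ℝ} (hv : v < ∑ m, lam m * robustPayoff uS uR (ν m)) :
    ∀ᶠ δ : ℝ in 𝓝 0,
      v < ∑ m, lam m * robustPayoff uS uR (fun ω => (1 - δ) * ν m ω + δ * μ ω) := by
  simp only [← robustPayoff_const_mul uS uR (hs.weights.1 _)] at hv ⊢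
  have hlsc : LowerSemicontinuous fun δ : ℝ =>
      ∑ m, robustPayoff uS uR fun ω => lam m * ((1 - δ) * ν m ω + δ * μ ω) :=
    lowerSemicontinuous_sum fun m _ =>
      (lowerSemicontinuous_robustPayoff uS uR).comp (by fun_prop)
  exact hlsc 0 v (by simpa using hv)

/-- Mixing the posteriors with a little of the prior gives them full support and strictly reduces
the information, while the payoff drops little by lower semicontinuity. -/
theorem exists_isSplitting_full_support_of_lt_splittingValue [Finite A] [Nonempty A]
    (hμ : μ ∈ stdSimplex ℝ Ω) {c : EReal} (hc : 0 < c) {v : ℝ} (hv : v < splittingValue uS uR μ c) :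
    ∃ (M : ℕ) (lam : Fin M → ℝ) (ν : Fin M → Ω → ℝ), IsSplitting μ lam ν ∧
      (∀ m ω, ν m ω = 0 → μ ω = 0) ∧ ((mutualInfoNat lam ν / log 2 : ℝ) : EReal) < c ∧
      v < ∑ m, lam m * robustPayoff uS uR (ν m) := by
  obtain ⟨M, lam, ν, hs, hinfo, hpayoff⟩ : ∃ (M : ℕ) (lam : Fin M → ℝ) (ν : Fin M → Ω → ℝ),
      IsSplitting μ lam ν ∧ ((mutualInfoNat lam ν / log 2 : ℝ) : EReal) ≤ c ∧
      v < ∑ m, lam m * robustPayoff uS uR (ν m) := by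
    by_contra! h
    exact hv.not_ge (splittingValue_le hμ hc.le h)
  obtain ⟨δ, hδ, hδ0, hδ1⟩ := (((hs.eventually_lt_sum_mul_robustPayoff_mix_prior
    hpayoff).filter_mono nhdsWithin_le_nhds).and (Ioo_mem_nhdsGT one_pos)).exists
  refine ⟨M, lam, _, hs.mix_prior hδ0.le hδ1.le, fun m ω h => ?_, ?_, hδ⟩
  · have hν := mul_nonneg (sub_nonneg.2 hδ1.le) ((hs.posteriors m).1 ω)
    have hμω := mul_nonneg hδ0.le (hμ.1 ω)
    exact (mul_eq_zero.1 ((add_eq_zero_iff_of_nonneg hν hμω).1 h).2).resolve_left hδ0.ne'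
  · have hlog := log_pos one_lt_two
    have hmix := hs.mutualInfoNat_mix_prior_le hδ0.le hδ1.le
    rcases (mutualInfoNat_nonneg hs.weights hs.posteriors).eq_or_lt with hzero | hpos
    · rw [← hzero, mul_zero] at hmix
      exact hc.trans_le' (by exact_mod_cast div_nonpos_of_nonpos_of_nonneg hmix hlog.le)
    · refine hinfo.trans_lt' (EReal.coe_lt_coe_iff.2 (div_lt_div_of_pos_right ?_ hlog))
      exact hmix.trans_lt (mul_lt_of_lt_one_left hpos (by linarith))

end FullSupport

section Limits

variable {ι : Type*} {l : Filter ι} {n k : ι → ℕ}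

theorem tendsto_atTop_of_tendsto_max_of_tendsto_div {r : ℝ} (hn : ∀ j, 0 < n j)
    (hmax : Tendsto (fun j => max (n j) (k j)) l atTop)
    (hk : Tendsto (fun j => (k j : ℝ) / n j) l (𝓝 r)) : Tendsto n l atTop := by
  have hfactor (j : ι) : (max (n j) (k j) : ℕ) * (max 1 ((k j : ℝ) / n j))⁻¹ = n j := by
    have hnj : (0 : ℝ) < n j := by exact_mod_cast hn j
    rw [← div_eq_mul_inv, div_eq_iff (by positivity), mul_max_of_nonneg _ _ hnj.le, mul_one,
      mul_div_cancel₀ _ hnj.ne', Nat.cast_max]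
  have hinv : Tendsto (fun j => (max 1 ((k j : ℝ) / n j))⁻¹) l (𝓝 (max 1 r)⁻¹) :=
    (tendsto_const_nhds.max hk).inv₀ (by positivity)
  rw [← tendsto_natCast_atTop_iff (R := ℝ)]
  simpa only [hfactor] using
    (tendsto_natCast_atTop_iff.2 hmax).atTop_mul_pos (by positivity) hinv

theorem tendsto_div_of_tendsto_ennreal_div {r : ENNReal} (hr : r ≠ ⊤)
    (hk : Tendsto (fun j => (k j : ENNReal) / (n j : ENNReal)) l (𝓝 r)) :
    Tendsto (fun j => (k j : ℝ) / n j) l (𝓝 r.toReal) := by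
  simpa [Function.comp_def] using (ENNReal.tendsto_toReal hr).comp hk

theorem tendsto_div_atTop_of_tendsto_ennreal_div (hn : ∀ j, 0 < n j)
    (hk : Tendsto (fun j => (k j : ENNReal) / (n j : ENNReal)) l (𝓝 ⊤)) :
    Tendsto (fun j => (k j : ℝ) / n j) l atTop := by
  rw [← ENNReal.tendsto_ofReal_nhds_top]
  simpa only [Function.comp_def, ENNReal.ofReal_div_of_pos (Nat.cast_pos.2 (hn _)),
    ENNReal.ofReal_natCast] using hk

variable {Ω A X Y : Type*} [Fintype Ω] [Finite A] [Nonempty A] [Fintype X] [Nonempty X]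
  [Fintype Y] {uS uR : Ω → A → ℝ} {μ : Ω → ℝ} {Q : X → Y → ℝ}

theorem eventually_lt_optimalRobustPayoff_of_pos (hμ : μ ∈ stdSimplex ℝ Ω)
    (hQ : ∀ x, Q x ∈ stdSimplex ℝ Y) (hC : 0 < capacity Q) {r : ℝ} (hr : 0 < r)
    (hn : Tendsto n l atTop) (hk : Tendsto (fun j => (k j : ℝ) / n j) l (𝓝 r)) {v : ℝ}
    (hv : v < splittingValue uS uR μ ((r * capacity Q : ℝ) : EReal)) :
    ∀ᶠ j in l, v < optimalRobustPayoff uS uR μ Q (n j) (k j) := by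
  have hlog := log_pos one_lt_two
  obtain ⟨M, lam, ν, hs, hfull, hinfo, hpayoff⟩ :=
    exists_isSplitting_full_support_of_lt_splittingValue hμ
      (by exact_mod_cast mul_pos hr hC) hv
  have hinfo : mutualInfoNat lam ν / (capacity Q * log 2) < r := by
    rw [EReal.coe_lt_coe_iff, div_lt_iff₀ hlog] at hinfo
    rwa [div_lt_iff₀ (by positivity), ← mul_assoc]
  obtain ⟨r', hr', hr'r⟩ := exists_between hinfo
  have hr'0 : 0 < r' :=
    (div_nonneg (mutualInfoNat_nonneg hs.weights hs.posteriors) (by positivity)).trans_lt hr'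
  rw [div_lt_iff₀ (by positivity)] at hr'
  filter_upwards [hn.eventually (hs.eventually_le_optimalRobustPayoff (uS := uS) (uR := uR) hfull hQ
    hr'0 hr' (half_pos (sub_pos.2 hpayoff))), hn.eventually_gt_atTop 0,
    hk.eventually_const_le hr'r] with j hguarantee hnj hratio
  linarith [hguarantee (k j) ((le_div_iff₀ (by exact_mod_cast hnj)).1 hratio)]

theorem eventually_lt_optimalRobustPayoff_of_atTop (hμ : μ ∈ stdSimplex ℝ Ω)
    (hQ : ∀ x, Q x ∈ stdSimplex ℝ Y) (hC : 0 < capacity Q) (hn : ∀ j, 0 < n j)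
    (hk : Tendsto (fun j => (k j : ℝ) / n j) l atTop) {v : ℝ}
    (hv : v < splittingValue uS uR μ ⊤) :
    ∀ᶠ j in l, v < optimalRobustPayoff uS uR μ Q (n j) (k j) := by
  obtain ⟨M, lam, ν, hs, hfull, -, hpayoff⟩ :=
    exists_isSplitting_full_support_of_lt_splittingValue hμ EReal.zero_lt_top hv
  obtain ⟨r, hr⟩ := exists_gt (mutualInfoNat lam ν / (capacity Q * log 2))
  have hlog := log_pos one_lt_two
  have hr0 : 0 < r :=
    (div_nonneg (mutualInfoNat_nonneg hs.weights hs.posteriors) (by positivity)).trans_lt hr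
  rw [div_lt_iff₀ (by positivity)] at hr
  have hε := half_pos (sub_pos.2 hpayoff)
  obtain ⟨N, hlarge⟩ := eventually_atTop.1
    (hs.eventually_le_optimalRobustPayoff (uS := uS) (uR := uR) hfull hQ hr0 hr hε)
  have hsmall := (eventually_all_finset (Ioo 0 N)).2 fun i hi =>
    hs.eventually_le_optimalRobustPayoff_of_capacity_pos (uS := uS) (uR := uR) hfull hQ hC hε
      (Finset.mem_Ioo.1 hi).1
  have hk_atTop : Tendsto k l atTop := tendsto_natCast_atTop_iff.1 <| tendsto_atTop_mono
    (fun j => div_le_self (Nat.cast_nonneg _) (by exact_mod_cast hn j)) hk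
  filter_upwards [hk.eventually_ge_atTop r, hk_atTop.eventually hsmall] with j hratio hsmall
  rcases le_or_gt N (n j) with hN | hN
  · linarith [hlarge (n j) hN (k j) ((le_div_iff₀ (by exact_mod_cast hn j)).1 hratio)]
  · linarith [hsmall (n j) (Finset.mem_Ioo.2 ⟨hn j, hN⟩)]

theorem exists_splittingValue_le_add_mul (hμ : μ ∈ stdSimplex ℝ Ω)
    (hcont : ContinuousWithinAt (robustPayoff uS uR) (supportedBeliefs μ) μ) {ε : ℝ}
    (hε : 0 < ε) :
    ∃ K : ℝ, ∀ c : ℝ, 0 ≤ c →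
      splittingValue uS uR μ (c : EReal) ≤ robustPayoff uS uR μ + ε + K * c := by
  obtain ⟨B, hB⟩ := exists_forall_abs_robustPayoff_le uS uR
  obtain ⟨K, hK, hdiv⟩ := exists_sub_mul_divergence_le (f := fun q => -robustPayoff uS uR q)
    (by simpa only [abs_neg] using hB) hμ hε hcont.neg.lowerSemicontinuousWithinAt
  refine ⟨K * log 2, fun c hc => splittingValue_le hμ (by exact_mod_cast hc)
    fun M lam ν hs hinfo => ?_⟩
  have hinfo : mutualInfoNat lam ν / log 2 ≤ c := by exact_mod_cast hinfo
  rw [div_le_iff₀ (log_pos one_lt_two)] at hinfo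
  have hpayoff (m : Fin M) : lam m * robustPayoff uS uR (ν m) ≤
      lam m * (robustPayoff uS uR μ + ε) + K * (lam m * divergence (ν m) μ) := by
    rcases (hs.weights.1 m).eq_or_lt with hm | hm
    · simp [← hm]
    · nlinarith [hdiv (ν m) (hs.posterior_mem_supportedBeliefs hm)]
  calc ∑ m, lam m * robustPayoff uS uR (ν m)
      ≤ ∑ m, (lam m * (robustPayoff uS uR μ + ε) + K * (lam m * divergence (ν m) μ)) :=
        sum_le_sum fun m _ => hpayoff m
    _ = robustPayoff uS uR μ + ε + K * mutualInfoNat lam ν := by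
        rw [sum_add_distrib, ← sum_mul, hs.weights.2, one_mul, ← mul_sum,
          hs.mutualInfoNat_eq_sum_mul_divergence]
    _ ≤ robustPayoff uS uR μ + ε + K * (c * log 2) := by gcongr
    _ = robustPayoff uS uR μ + ε + K * log 2 * c := by ring

theorem tendsto_optimalRobustPayoff_of_pos (hμ : μ ∈ stdSimplex ℝ Ω)
    (hQ : ∀ x, Q x ∈ stdSimplex ℝ Y) (hC : 0 < capacity Q) {r : ℝ} (hr : 0 < r)
    (hn : Tendsto n l atTop) (hk : Tendsto (fun j => (k j : ℝ) / n j) l (𝓝 r)) :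
    Tendsto (fun j => optimalRobustPayoff uS uR μ Q (n j) (k j)) l
      (𝓝 (splittingValue uS uR μ ((r * capacity Q : ℝ) : EReal))) := by
  refine tendsto_order.2
    ⟨fun v hv => eventually_lt_optimalRobustPayoff_of_pos hμ hQ hC hr hn hk hv, fun v hv => ?_⟩
  filter_upwards [hn.eventually_gt_atTop 0, (hk.mul_const (capacity Q)).eventually
    (upperSemicontinuousAt_splittingValue hμ (mul_pos hr hC) v hv)] with j hnj hj
  exact (optimalRobustPayoff_le_splittingValue hnj hμ hQ).trans_lt hj

theorem tendsto_optimalRobustPayoff_of_zero (hμ : μ ∈ stdSimplex ℝ Ω)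
    (hQ : ∀ x, Q x ∈ stdSimplex ℝ Y)
    (hcont : ContinuousWithinAt (robustPayoff uS uR) (supportedBeliefs μ) μ)
    (hn : ∀ j, 0 < n j) (hk : Tendsto (fun j => (k j : ℝ) / n j) l (𝓝 0)) :
    Tendsto (fun j => optimalRobustPayoff uS uR μ Q (n j) (k j)) l
      (𝓝 (robustPayoff uS uR μ)) := by
  refine tendsto_order.2 ⟨fun v hv => Eventually.of_forall fun j =>
    hv.trans_le (robustPayoff_le_optimalRobustPayoff (hn j) hμ hQ), fun v hv => ?_⟩
  obtain ⟨K, hK⟩ := exists_splittingValue_le_add_mul hμ hcont (half_pos (sub_pos.2 hv))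
  have hbound := ((hk.mul_const (capacity Q)).const_mul K).const_add
    (robustPayoff uS uR μ + (v - robustPayoff uS uR μ) / 2)
  filter_upwards [hbound.eventually_lt_const (show _ < v by linarith)] with j hj
  exact ((optimalRobustPayoff_le_splittingValue (hn j) hμ hQ).trans
    (hK _ (mul_nonneg (by positivity) (capacity_nonneg hQ)))).trans_lt hj

theorem tendsto_optimalRobustPayoff_of_atTop (hμ : μ ∈ stdSimplex ℝ Ω)
    (hQ : ∀ x, Q x ∈ stdSimplex ℝ Y) (hC : 0 < capacity Q) (hn : ∀ j, 0 < n j)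
    (hk : Tendsto (fun j => (k j : ℝ) / n j) l atTop) :
    Tendsto (fun j => optimalRobustPayoff uS uR μ Q (n j) (k j)) l
      (𝓝 (splittingValue uS uR μ ⊤)) := by
  refine tendsto_order.2
    ⟨fun v hv => eventually_lt_optimalRobustPayoff_of_atTop hμ hQ hC hn hk hv,
      fun v hv => Eventually.of_forall fun j => lt_of_le_of_lt ?_ hv⟩
  exact (optimalRobustPayoff_le_splittingValue (hn j) hμ hQ).trans
    (splittingValue_mono hμ (by exact_mod_cast (by positivity)) le_top)

theorem optimalRobustPayoff_eq_of_capacity_eq_zero (hμ : μ ∈ stdSimplex ℝ Ω)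
    (hQ : ∀ x, Q x ∈ stdSimplex ℝ Y) (hC : capacity Q = 0) {n k : ℕ} (hn : 0 < n) :
    optimalRobustPayoff uS uR μ Q n k = robustPayoff uS uR μ := by
  refine le_antisymm ?_ (robustPayoff_le_optimalRobustPayoff hn hμ hQ)
  simpa only [hC, mul_zero, EReal.coe_zero, splittingValue_zero hμ] using
    optimalRobustPayoff_le_splittingValue (uS := uS) (uR := uR) (k := k) hn hμ hQ

end Limits

end

end Persuasion

open Persuasion Filter Topology in
theorem theorem1 {Ω A X Y : Type*} [Fintype Ω] [Fintype A] [Nonempty A]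
    [Fintype X] [Nonempty X] [Fintype Y]
    (uS uR : Ω → A → ℝ) (μ : Ω → ℝ) (hμ : μ ∈ stdSimplex ℝ Ω)
    (Q : X → Y → ℝ) (hQ : ∀ x, Q x ∈ stdSimplex ℝ Y) :
    (∀ n k : ℕ, 0 < n →
      optimalRobustPayoff uS uR μ Q n k ≤
        splittingValue uS uR μ (((k : ℝ) / (n : ℝ) * capacity Q : ℝ) : EReal)) ∧
    (∀ (r : ENNReal) (n k : ℕ → ℕ),
      (r = 0 → capacity Q ≠ 0 →
        ContinuousWithinAt (robustPayoff uS uR)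
          {ν | ν ∈ stdSimplex ℝ Ω ∧ ∀ ω, μ ω = 0 → ν ω = 0} μ) →
      (∀ j, 0 < n j) →
      Tendsto (fun j => max (n j) (k j)) atTop atTop →
      Tendsto (fun j => (k j : ENNReal) / (n j : ENNReal)) atTop (𝓝 r) →
      Tendsto (fun j => optimalRobustPayoff uS uR μ Q (n j) (k j)) atTop
        (𝓝 (splittingValue uS uR μ ((r : EReal) * (capacity Q : EReal))))) := by
  refine ⟨fun n k hn => optimalRobustPayoff_le_splittingValue hn hμ hQ,
    fun r n k hcont hn hmax hk => ?_⟩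
  rcases (capacity_nonneg hQ).eq_or_lt' with hC | hC
  · simp only [optimalRobustPayoff_eq_of_capacity_eq_zero hμ hQ hC (hn _), hC, EReal.coe_zero,
      mul_zero, splittingValue_zero hμ, tendsto_const_nhds]
  rcases eq_or_ne r ⊤ with rfl | hr
  · rw [EReal.coe_ennreal_top, EReal.top_mul_coe_of_pos hC]
    exact tendsto_optimalRobustPayoff_of_atTop hμ hQ hC hn
      (tendsto_div_atTop_of_tendsto_ennreal_div hn hk)
  replace hk := tendsto_div_of_tendsto_ennreal_div hr hk
  rcases eq_or_ne r 0 with rfl | hr0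
  · rw [EReal.coe_ennreal_zero, zero_mul, splittingValue_zero hμ]
    exact tendsto_optimalRobustPayoff_of_zero hμ hQ (hcont rfl hC.ne') hn hk
  · rw [← EReal.coe_ennreal_toReal hr, ← EReal.coe_mul]
    exact tendsto_optimalRobustPayoff_of_pos hμ hQ hC (ENNReal.toReal_pos hr0 hr)
      (tendsto_atTop_of_tendsto_max_of_tendsto_div hn hmax hk) hk
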